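/- **Theorem (FWER control of the naive max-statistic test).** Let $(X,T,Y(0),Y(1))$ be a random vector in $\mathbb R^d\times\{0,1\}\times\mathbb R\times\mathbb R$ with $(Y(0),Y(1))\perp\!\!\!\perp T\mid X$, and put $Y=TY(1)+(1-T)Y(0)$, $e(x)=\mathbb P(T=1\mid X=x)$, $\mu_t(x)=\mathbb E[Y\mid T=t,X=x]$, $\tau(x)=\mathbb E[Y(1)-Y(0)\mid X=x]$. Let $\hat\tau_1,\dots,\hat\tau_K$ be fixed measurable candidate estimators of $\tau$ (trained on data independent of the test sample) with $\mathbb E[\hat\tau_k(X)^2]<\infty$, and let $\delta(f,g)=\mathbb E[(f(X)-\tau(X))^2]-\mathbb E[(g(X)-\tau(X))^2]$. For each $n$, the test sample $Z_i=(X_i,T_i,Y_i)$, $i\le n$, is i.i.d. with the law of $(X,T,Y)$, and its index set is split into two folds $A_n,B_n$ that do not depend on the data, with $|A_n|/n\to\frac12$. Nuisance estimators $\hat\eta_M=(\tilde\mu_0,\tilde\mu_1,\tilde e)$ are measurable functions of the data in the fold $M\in\{A_n,B_n\}$. *Selector.* For a nuisance triple $\eta=(\tilde\mu_0,\tilde\mu_1,\tilde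 e)$ let $$\hat t(Z;f,g;\eta)=f^2(X)-g^2(X)-2(f(X)-g(X))\Big(\tfrac{T(Y-\tilde\mu_1(X))}{\tilde e(X)}+\tilde\mu_1(X)-\tfrac{(1-T)(Y-\tilde\mu_0(X))}{1-\tilde e(X)}-\tilde\mu_0(X)\Big).$$ Let $\hat t_i(f,g)$ be $\hat t(Z_i;f,g;\hat\eta_{B_n})$ for $i\in A_n$ and $\hat t(Z_i;f,g;\hat\eta_{A_n})$ for $i\in B_n$, and $\hat\delta(f,g)=\frac12\big[\frac1{|A_n|}\sum_{i\in A_n}\hat t_i(f,g)+\frac1{|B_n|}\sum_{i\in B_n}\hat t_i(f,g)\big]$. For each $m$ let $\hat\Sigma_m$ be the matrix indexed by $s,s'\ne m$ with entries $$(\hat\Sigma_m)_{ss'}=\frac1{n^2}\sum_{i=1}^n\big(\hat t_i(\hat\tau_m,\hat\tau_s)-\hat\delta(\hat\tau_m,\hat\tau_s)\big)\big(\hat t_i(\hat\tau_m,\hat\tau_{s'})-\hat\delta(\hat\tau_m,\hat\tau_{s'})\big).$$ Given the data, draw $\tilde B_n\ge1$ independent vectors $G^{(b)}_m\sim\mathcal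 N(0,\hat\Sigma_m)$; let $c^{(m)}_{1-\alpha}$ be the empirical $(1-\alpha)$-quantile (the smallest $c$ such that at least a fraction $1-\alpha$ of the values is $\le c$) of $\max_{s\ne m}(G^{(b)}_m)_s/\sqrt{(\hat\Sigma_m)_{ss}}$, $b\le\tilde B_n$. Then $\hat{\mathcal S}_{naive}$ is the set of all $m$ with $\max_{s\ne m}\hat\delta(\hat\tau_m,\hat\tau_s)/\sqrt{(\hat\Sigma_m)_{ss}}\le c^{(m)}_{1-\alpha}$. (Conventions: $a/0=0$, and a maximum over the empty set is $0$.) *Assumptions.* 1. $Y$ is a.s. bounded, and there is $\eta>0$ with $\eta<e(X)<1-\eta$ a.s. 2. For the nuisance estimators trained on either fold, with norms and expectations taken over an independent $X$: $\|\tilde\mu_1-\mu_1\|_{L^2(P_X)}$, $\|\tilde\mu_0-\mu_0\|_{L^2(P_X)}$, $\|\tilde e-e\|_{L^2(P_X)}$ are $o_p(1)$, and $\mathbb E[(\tilde\mu_t(X)-\mu_t(X))(\tilde e(X)-e(X))]=o_p(n^{-1/2})$ for $t=0,1$. Moreover there is $\eta'>0$ such that, with probability tending to one, $\eta'<\tilde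 e(X)<1-\eta'$ for $P_X$-almost every $X$. 3. $\mathbb E[(\hat\tau_r(X)-\hat\tau_s(X))^2]\neq0$ for all $r\ne s$. Suppose that $\hat\tau_{(1)}$ is the (unique) true winner, i.e. the candidate with $\delta(\hat\tau_{(1)},\hat\tau_s)<0$ for every other candidate $\hat\tau_s$. Then for every $\alpha\in(0,1)$ and every choice of the numbers $\tilde B_n\ge1$ of resamples, the limit below exists and $$\lim_{n\to\infty}\mathbb P\big(\hat\tau_{(1)}\in\hat{\mathcal S}_{naive}\big)\ \ge\ 1-\alpha,$$ where the probability is over the test sample and the bootstrap draws. -/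

import Mathlib

open MeasureTheory ProbabilityTheory Filter Topology
open scoped ENNReal

noncomputable section

namespace HTE

/-- Covariate space `ℝ^d`. -/
abbrev Cov (d : ℕ) : Type := EuclideanSpace ℝ (Fin d)

/-- A unit of the super-population: `(X, T, Y(0), Y(1))`. -/
abbrev Full (d : ℕ) : Type := Cov d × Bool × ℝ × ℝ

/-- An observed data point `Z = (X, T, Y)`. -/
abbrev Obs (d : ℕ) : Type := Cov d × Bool × ℝ

/-! ### The super-population -/

/-- The covariates `X`. -/
def covX {d : ℕ} (u : Full d) : Cov d := u.1

/-- The treatment indicator `T`; `true` means treated. -/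
def treat {d : ℕ} (u : Full d) : Bool := u.2.1

/-- The potential outcome `Y(0)`. -/
def pot0 {d : ℕ} (u : Full d) : ℝ := u.2.2.1

/-- The potential outcome `Y(1)`. -/
def pot1 {d : ℕ} (u : Full d) : ℝ := u.2.2.2

/-- The observed outcome `Y = T Y(1) + (1 - T) Y(0)`. -/
def outcome {d : ℕ} (u : Full d) : ℝ := if treat u then pot1 u else pot0 u

/-- The law of the covariates. -/
def covLaw {d : ℕ} (P : Measure (Full d)) : Measure (Cov d) := P.map covX

/-- The law of one observed data point. -/
def obsLaw {d : ℕ} (P : Measure (Full d)) : Measure (Obs d) :=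
  P.map fun u => (covX u, treat u, outcome u)

/-- The law of an i.i.d. test sample of size `n`. -/
def sampleLaw {d : ℕ} (P : Measure (Full d)) (n : ℕ) : Measure (Fin n → Obs d) :=
  Measure.pi fun _ => obsLaw P

/-- The propensity score `e(x) = P(T = 1 | X = x)`. -/
def propensity {d : ℕ} (P : Measure (Full d)) [IsProbabilityMeasure P] (x : Cov d) : ℝ :=
  (condDistrib treat covX P x).real {true}

/-- The outcome regression `μ_t(x) = E[Y | T = t, X = x]`. -/
def regression {d : ℕ} (P : Measure (Full d)) [IsProbabilityMeasure P] (t : Bool) (x : Cov d) : ℝ :=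
  ∫ y, y ∂(condDistrib outcome (fun u => (covX u, treat u)) P (x, t))

/-- The conditional average treatment effect `τ(x) = E[Y(1) - Y(0) | X = x]`. -/
def cate {d : ℕ} (P : Measure (Full d)) [IsProbabilityMeasure P] (x : Cov d) : ℝ :=
  ∫ y, y ∂(condDistrib (fun u => pot1 u - pot0 u) covX P x)

/-- Unconfoundedness: `(Y(0), Y(1))` and `T` are conditionally independent given `X`. -/
def Unconfounded {d : ℕ} (P : Measure (Full d)) [IsProbabilityMeasure P] : Prop :=
  CondIndepFun (MeasurableSpace.comap covX inferInstance)
    (Measurable.comap_le (by unfold covX; fun_prop : Measurable (covX (d := d))))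
    (fun u => (pot0 u, pot1 u)) treat P

/-- The outcome is bounded and the propensity score is bounded away from `0` and `1`. -/
def BoundedOverlap {d : ℕ} (P : Measure (Full d)) [IsProbabilityMeasure P] : Prop :=
  (∃ C : ℝ, ∀ᵐ u ∂P, |outcome u| ≤ C) ∧
  ∃ η : ℝ, 0 < η ∧ ∀ᵐ x ∂(covLaw P), η < propensity P x ∧ propensity P x < 1 - η

/-- The mean squared error `E[(f(X) - τ(X))²]` of a candidate `f`. -/
def risk {d : ℕ} (P : Measure (Full d)) [IsProbabilityMeasure P] (f : Cov d → ℝ) : ℝ :=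
  ∫ x, (f x - cate P x) ^ 2 ∂(covLaw P)

/-- The relative error `δ(f, g)`. -/
def relErr {d : ℕ} (P : Measure (Full d)) [IsProbabilityMeasure P] (f g : Cov d → ℝ) : ℝ :=
  risk P f - risk P g

/-! ### Nuisance estimators and cross-fitting -/

/-- A triple of nuisance functions: outcome regressions and propensity score. -/
structure Nuisance (d : ℕ) where
  /-- the outcome regression of the control arm (`false`) and of the treated arm (`true`) -/
  mu : Bool → Cov d → ℝ
  /-- the propensity score -/
  e : Cov d → ℝ

/-- A nuisance learner: for a sample of size `n` and a fold `s`, it maps the data of the fold `s`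
(and nothing else) to nuisance estimates. -/
abbrev Learner (d : ℕ) : Type :=
  (n : ℕ) → (s : Finset (Fin n)) → (s → Obs d) → Nuisance d

/-- The estimates are jointly measurable in the training data and the evaluation point. -/
def Learner.IsMeasurable {d : ℕ} (L : Learner d) : Prop :=
  ∀ (n : ℕ) (s : Finset (Fin n)),
    (∀ t, Measurable fun p : (s → Obs d) × Cov d => (L n s p.1).mu t p.2) ∧
    Measurable fun p : (s → Obs d) × Cov d => (L n s p.1).e p.2

/-- The nuisance estimate trained on the fold `s` of the sample `z`. -/
def Learner.fit {d : ℕ} (L : Learner d) {n : ℕ} (s : Finset (Fin n)) (z : Fin n → Obs d) :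
    Nuisance d :=
  L n s fun i => z i

/-- `R n = o_p(1)` for nonnegative random quantities `R n`, each on its own space. -/
def IsLittleOpOne {Ω : ℕ → Type*} [∀ n, MeasurableSpace (Ω n)] (μ : ∀ n, Measure (Ω n))
    (R : ∀ n, Ω n → ℝ≥0∞) : Prop :=
  ∀ ε : ℝ, 0 < ε → Tendsto (fun n => μ n {ω | ENNReal.ofReal ε ≤ R n ω}) atTop (𝓝 0)

/-- Consistency of the nuisance estimates trained on the folds `F n`: the `L²(P_X)` errors are
`o_p(1)` and the cross moments `E[(μ̃_t(X) - μ_t(X)) (ẽ(X) - e(X))]`, over a fresh `X`, are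
`o_p(n^{-1/2})`. -/
def ConsistentNuisance {d : ℕ} (P : Measure (Full d)) [IsProbabilityMeasure P] (L : Learner d)
    (F : (n : ℕ) → Finset (Fin n)) : Prop :=
  (∀ t, IsLittleOpOne (sampleLaw P) fun n z =>
    eLpNorm (fun x => (L.fit (F n) z).mu t x - regression P t x) 2 (covLaw P)) ∧
  IsLittleOpOne (sampleLaw P) (fun n z =>
    eLpNorm (fun x => (L.fit (F n) z).e x - propensity P x) 2 (covLaw P)) ∧
  ∀ t, IsLittleOpOne (sampleLaw P) fun n z =>
    ENNReal.ofReal (√n * |∫ x, ((L.fit (F n) z).mu t x - regression P t x) *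
      ((L.fit (F n) z).e x - propensity P x) ∂(covLaw P)|)

/-- With probability tending to one, the estimated propensity score trained on the fold `F n` is
bounded away from `0` and `1`. -/
def EstimatedOverlap {d : ℕ} (P : Measure (Full d)) (L : Learner d)
    (F : (n : ℕ) → Finset (Fin n)) : Prop :=
  ∃ η : ℝ, 0 < η ∧ Tendsto (fun n => sampleLaw P n
    {z | ¬ ∀ᵐ x ∂(covLaw P), η < (L.fit (F n) z).e x ∧ (L.fit (F n) z).e x < 1 - η}) atTop (𝓝 0)

/-- The one-step corrected score `t̂(Z; f, g; η)` of the relative error. -/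
def score {d : ℕ} (η : Nuisance d) (f g : Cov d → ℝ) (z : Obs d) : ℝ :=
  let x := z.1
  let w : ℝ := if z.2.1 then 1 else 0
  let y := z.2.2
  (f x ^ 2 - g x ^ 2) - 2 * (f x - g x) *
    (w * (y - η.mu true x) / η.e x + η.mu true x
      - (1 - w) * (y - η.mu false x) / (1 - η.e x) - η.mu false x)

/-- The cross-fitted score of the `i`-th data point: the folds are `A` and its complement, and the
nuisances are trained on the fold that does not contain `i`. -/
def crossScore {d n : ℕ} (L : Learner d) (A : Finset (Fin n)) (z : Fin n → Obs d)
    (f g : Cov d → ℝ) (i : Fin n) : ℝ :=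
  if i ∈ A then score (L.fit Aᶜ z) f g (z i) else score (L.fit A z) f g (z i)

/-- The cross-fitted estimate `δ̂(f, g)`: the average of the two fold means. -/
def relErrHat {d n : ℕ} (L : Learner d) (A : Finset (Fin n)) (z : Fin n → Obs d)
    (f g : Cov d → ℝ) : ℝ :=
  (1 / 2) * ((1 / (A.card : ℝ)) * ∑ i ∈ A, crossScore L A z f g i
    + (1 / (Aᶜ.card : ℝ)) * ∑ i ∈ Aᶜ, crossScore L A z f g i)

/-! ### The naive max-statistic selector -/

/-- The index set `I_m`, i.e. all candidates but `m`. -/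
abbrev Others {K : ℕ} (m : Fin K) : Type := {s : Fin K // s ≠ m}

/-- The estimated covariance matrix `Σ̂_m` of the vector `(δ̂(τ̂_m, τ̂_s))_{s ≠ m}`: the empirical
covariance of the score vectors, divided by `n`. -/
def covHat {d n K : ℕ} (L : Learner d) (A : Finset (Fin n)) (z : Fin n → Obs d)
    (τhat : Fin K → Cov d → ℝ) (m : Fin K) : Matrix (Others m) (Others m) ℝ :=
  Matrix.of fun s s' => (1 / (n : ℝ)) * ((1 / (n : ℝ)) * ∑ i,
    (crossScore L A z (τhat m) (τhat s) i - relErrHat L A z (τhat m) (τhat s)) *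
    (crossScore L A z (τhat m) (τhat s') i - relErrHat L A z (τhat m) (τhat s')))

/-- The max-statistic `S_m^max = max_{s ≠ m} δ̂(τ̂_m, τ̂_s) / σ̂_{m,s}`. -/
def maxStat {d n K : ℕ} (L : Learner d) (A : Finset (Fin n)) (z : Fin n → Obs d)
    (τhat : Fin K → Cov d → ℝ) (m : Fin K) : ℝ :=
  ⨆ s : Others m, relErrHat L A z (τhat m) (τhat s) / √(covHat L A z τhat m s s)

/-- The empirical `p`-quantile of `M 0, …, M (B - 1)`. -/
def empQuantile {B : ℕ} (p : ℝ) (M : Fin B → ℝ) : ℝ :=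
  sInf {c : ℝ | p ≤ ((Finset.univ.filter fun b => M b ≤ c).card : ℝ) / (B : ℝ)}

/-- The critical value `c_{1-α}^{(m)}` computed from resamples `G^{(1)}, …, G^{(B)}`. -/
def critVal {K B : ℕ} {m : Fin K} (α : ℝ) (S : Matrix (Others m) (Others m) ℝ)
    (G : Fin B → EuclideanSpace ℝ (Others m)) : ℝ :=
  empQuantile (1 - α) fun b => ⨆ s : Others m, G b s / √(S s s)

/-- The set selected from the data `z` and the bootstrap draws `G`. -/
def naiveSet {d n K B : ℕ} (L : Learner d) (A : Finset (Fin n)) (τhat : Fin K → Cov d → ℝ)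
    (α : ℝ) (z : Fin n → Obs d) (G : (m : Fin K) → Fin B → EuclideanSpace ℝ (Others m)) :
    Set (Fin K) :=
  {m | maxStat L A z τhat m ≤ critVal α (covHat L A z τhat m) (G m)}

/-- The conditional law of the bootstrap draws given the data: independent, with
`G m b ∼ N(0, Σ̂_m)`. -/
def bootLaw {d n K : ℕ} (L : Learner d) (A : Finset (Fin n)) (τhat : Fin K → Cov d → ℝ)
    (B : ℕ) (z : Fin n → Obs d) :
    Measure ((m : Fin K) → Fin B → EuclideanSpace ℝ (Others m)) :=
  Measure.pi fun m => Measure.pi fun _ => multivariateGaussian 0 (covHat L A z τhat m)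

/-- The probability, over the test sample of size `n` and the `B` bootstrap draws, that the
candidate `m` belongs to the selected set. -/
def selectProb {d n K : ℕ} (P : Measure (Full d)) (L : Learner d) (A : Finset (Fin n))
    (τhat : Fin K → Cov d → ℝ) (α : ℝ) (B : ℕ) (m : Fin K) : ℝ :=
  (∫⁻ z, bootLaw L A τhat B z {G | m ∈ naiveSet L A τhat α z G} ∂(sampleLaw P n)).toReal

end HTE

end

/-!
The true winner `w` has `δ(τ̂_w, τ̂_s) < 0` for every competitor `s`, so its max-statistic tends to
`-∞` while the bootstrap critical value stays bounded below in probability: the limit of the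
selection probability is `1`. Consistency therefore suffices, and no central limit theorem is
needed.

*Identification.* Unconfoundedness says that on an arm `T = t` the joint law of the covariates and
the potential outcomes has density `P(T = t | X)` (`map_restrict_treat`). Under overlap this makes
both potential outcomes and both regressions bounded, and gives the score with the true nuisances
the mean `δ(f, g)` (`integrable_score_oracle_and_integral_eq`).

*Cross-fitting.* The score is Lipschitz in the nuisances where overlap holds, so its mean absolute
error over a fresh observation is at most a constant times the sum of the `L²` errors
(`lintegral_score_sub_oracle_le`). Since each fold is independent of the fold on which its nuisances
are trained, a conditional Markov inequality gives an `o_p(1)` bound on the average error of the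
scores (`withHighProb_sum_abs_score_sub_oracle_le`). Together with the weak law of large numbers on
the folds, `δ̂ → δ` in probability.

*Variance.* The candidates are only square integrable, so that the scores are only integrable and
`n Σ̂` need not be bounded. It is enough that `Σ̂ → 0` in probability, which holds since
`n⁻² ∑ᵢ tᵢ² → 0` for i.i.d. integrable `tᵢ` (`withHighProb_sum_sq_le`) and since the squared errors
of the scores sum to at most the square of the sum of the errors.

*Critical value.* If the empirical quantile of the resamples is below `-M`, then at least a fraction
`1 - α` of the resampled maxima is at most `-M`; by the inequalities of Markov and Chebyshev this
has conditional probability at most `1 / ((1 - α) M²)`, whatever the number of resamples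
(`one_le_bootLaw_add`). If an estimated variance vanishes, the corresponding ratio is `0` both in
the statistic and in every resample, and `w` is selected.

The selection event is not shown to be measurable; all bounds are on outer measures of complements
of events, and on lower integrals (`one_le_lintegral_add`).
-/

namespace HTE

section Population

variable {d : ℕ}

/-! ### Identification in the super-population -/

@[fun_prop]
lemma measurable_covX : Measurable (covX (d := d)) := by unfold covX; fun_prop

@[fun_prop]
lemma measurable_treat : Measurable (treat (d := d)) := by unfold treat; fun_prop

@[fun_prop]
lemma measurable_pot0 : Measurable (pot0 (d := d)) := by unfold pot0; fun_prop

@[fun_prop]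
lemma measurable_pot1 : Measurable (pot1 (d := d)) := by unfold pot1; fun_prop

lemma measurableSet_treat (t : Bool) : MeasurableSet {u : Full d | treat u = t} :=
  measurable_treat (measurableSet_singleton t)

@[fun_prop]
lemma measurable_outcome : Measurable (outcome (d := d)) :=
  Measurable.ite (measurableSet_treat true) measurable_pot1 measurable_pot0

/-- The potential outcome under the treatment level `t`. -/
def pot (t : Bool) (u : Full d) : ℝ := if t then pot1 u else pot0 u

lemma outcome_eq_pot (u : Full d) : outcome u = pot (treat u) u := rfl

@[fun_prop]
lemma measurable_pot (t : Bool) : Measurable (pot (d := d) t) := by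
  cases t
  · exact measurable_pot0
  · exact measurable_pot1

/-- The conditional probability `P(T = t | X = x)`. -/
noncomputable def armProb (P : Measure (Full d)) [IsProbabilityMeasure P] (t : Bool) (x : Cov d) :
    ℝ :=
  (condDistrib treat covX P x).real {t}

variable (P : Measure (Full d)) [IsProbabilityMeasure P]

instance : IsProbabilityMeasure (covLaw P) :=
  Measure.isProbabilityMeasure_map measurable_covX.aemeasurable

instance : IsProbabilityMeasure (obsLaw P) :=
  Measure.isProbabilityMeasure_map
    (measurable_covX.prodMk (measurable_treat.prodMk measurable_outcome)).aemeasurable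

instance (n : ℕ) : IsProbabilityMeasure (sampleLaw P n) := by unfold sampleLaw; infer_instance

lemma armProb_true (x : Cov d) : armProb P true x = propensity P x := rfl

lemma armProb_false (x : Cov d) : armProb P false x = 1 - propensity P x := by
  have h : ({true} : Set Bool)ᶜ = {false} := by ext b; cases b <;> simp
  rw [armProb, propensity, ← h, probReal_compl_eq_one_sub (measurableSet_singleton _)]

@[fun_prop]
lemma measurable_armProb (t : Bool) : Measurable (armProb P t) :=
  (Kernel.measurable_coe _ (measurableSet_singleton t)).ennreal_toReal

@[fun_prop]
lemma measurable_propensity : Measurable (propensity P) := measurable_armProb P true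

@[fun_prop]
lemma measurable_regression (t : Bool) : Measurable (regression P t) := by
  have h : StronglyMeasurable fun p : Cov d × Bool =>
      ∫ y, y ∂(condDistrib outcome (fun u => (covX u, treat u)) P p) :=
    StronglyMeasurable.integral_condDistrib (f := fun q : (Cov d × Bool) × ℝ => q.2)
      measurable_snd.stronglyMeasurable
  exact h.measurable.comp (by fun_prop : Measurable fun x : Cov d => (x, t))

@[fun_prop]
lemma measurable_cate : Measurable (cate P) :=
  (StronglyMeasurable.integral_condDistrib (f := fun q : Cov d × ℝ => q.2)
    measurable_snd.stronglyMeasurable).measurable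

variable {P}

/-- Unconfoundedness as a change of measure: on the arm `T = t`, the joint law of the covariates
and the potential outcomes has density `P(T = t | X)` with respect to their law in the whole
population. -/
lemma map_restrict_treat (hunc : Unconfounded P) (t : Bool) :
    (P.restrict {u | treat u = t}).map (fun u => (covX u, (pot0 u, pot1 u))) =
      (P.map fun u => (covX u, (pot0 u, pot1 u))).withDensity
        fun q => ENNReal.ofReal (armProb P t q.1) := by
  have hpots : Measurable fun u : Full d => (pot0 u, pot1 u) := by fun_prop
  have hk := (condIndepFun_iff_condDistrib_prod_ae_eq_prodMkRight (μ := P) measurable_treat hpots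
    measurable_covX).1 hunc
  have hX : Measurable fun u : Full d => (covX u, (pot0 u, pot1 u)) := by fun_prop
  ext s hs
  rw [Measure.map_apply hX hs, Measure.restrict_apply (hX hs), withDensity_apply _ hs]
  change P (_ ∩ treat ⁻¹' {t}) = _
  rw [← setLIntegral_preimage_condDistrib hX measurable_treat.aemeasurable
    (measurableSet_singleton t) hs, ← setLIntegral_map hs (Kernel.measurable_coe _
      (measurableSet_singleton t)) hX]
  refine lintegral_congr_ae (ae_restrict_of_ae ?_)
  filter_upwards [hk] with q hq
  rw [hq, Kernel.prodMkRight_apply, armProb, ofReal_measureReal]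

/-- Inverse probability weighting on the arm `T = t`. -/
lemma setIntegral_treat (hunc : Unconfounded P) (t : Bool) {φ : Cov d × ℝ × ℝ → ℝ}
    (hφ : Measurable φ) :
    ∫ u in {u | treat u = t}, φ (covX u, (pot0 u, pot1 u)) ∂P =
      ∫ u, armProb P t (covX u) * φ (covX u, (pot0 u, pot1 u)) ∂P := by
  have hX : Measurable fun u : Full d => (covX u, (pot0 u, pot1 u)) := by fun_prop
  rw [← integral_map (f := φ) hX.aemeasurable hφ.aestronglyMeasurable, map_restrict_treat hunc,
    integral_withDensity_eq_integral_toReal_smul (by fun_prop) (by simp),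
    integral_map hX.aemeasurable]
  · simp [armProb, Measure.real]
  · exact Measurable.aestronglyMeasurable (by fun_prop)

/-- A property of covariates and potential outcomes that holds on an arm with positive treatment
probability holds in the whole population. -/
lemma ae_of_ae_treat (hunc : Unconfounded P) (t : Bool)
    (hpos : ∀ᵐ x ∂(covLaw P), 0 < armProb P t x) {p : Cov d × ℝ × ℝ → Prop}
    (hp : MeasurableSet {q | p q})
    (h : ∀ᵐ u ∂P, treat u = t → p (covX u, (pot0 u, pot1 u))) :
    ∀ᵐ u ∂P, p (covX u, (pot0 u, pot1 u)) := by
  have hX : Measurable fun u : Full d => (covX u, (pot0 u, pot1 u)) := by fun_prop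
  have h1 : ∀ᵐ q ∂((P.restrict {u | treat u = t}).map fun u => (covX u, (pot0 u, pot1 u))), p q :=
    (ae_map_iff hX.aemeasurable hp).2 ((ae_restrict_iff' (measurableSet_treat t)).2 h)
  rw [map_restrict_treat hunc, ae_withDensity_iff (by fun_prop)] at h1
  have h2 := ae_of_ae_map hX.aemeasurable h1
  have h3 := ae_of_ae_map measurable_covX.aemeasurable hpos
  filter_upwards [h2, h3] with u hu hu'
  exact hu (by simpa using hu')

lemma ae_armProb_pos {η : ℝ} (hη : 0 < η)
    (h : ∀ᵐ x ∂(covLaw P), η < propensity P x ∧ propensity P x < 1 - η) (t : Bool) :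
    ∀ᵐ x ∂(covLaw P), 0 < armProb P t x := by
  filter_upwards [h] with x hx
  cases t
  · rw [armProb_false]; linarith
  · rw [armProb_true]; linarith

/-- Under overlap, a bound on the observed outcome bounds both potential outcomes. -/
lemma ae_abs_pot_le (hunc : Unconfounded P) (hpos : ∀ t, ∀ᵐ x ∂(covLaw P), 0 < armProb P t x)
    {C : ℝ} (hC : ∀ᵐ u ∂P, |outcome u| ≤ C) (t : Bool) : ∀ᵐ u ∂P, |pot t u| ≤ C := by
  refine ae_of_ae_treat hunc t (hpos t)
    (p := fun q : Cov d × ℝ × ℝ => |if t then q.2.2 else q.2.1| ≤ C) ?_ ?_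
  · exact measurableSet_le (by cases t <;> simp <;> fun_prop) measurable_const
  · filter_upwards [hC] with u hu ht
    rw [outcome_eq_pot, ht] at hu
    exact hu

lemma ae_abs_regression_le (hunc : Unconfounded P)
    (hpos : ∀ t, ∀ᵐ x ∂(covLaw P), 0 < armProb P t x)
    {C : ℝ} (hC : ∀ᵐ u ∂P, |outcome u| ≤ C) (t : Bool) :
    ∀ᵐ x ∂(covLaw P), |regression P t x| ≤ C := by
  have hXT : Measurable fun u : Full d => (covX u, treat u) := by fun_prop
  have hS : MeasurableSet {x : Cov d | |regression P t x| ≤ C} :=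
    measurableSet_le (by fun_prop) measurable_const
  refine (ae_map_iff measurable_covX.aemeasurable hS).2 ?_
  refine ae_of_ae_treat hunc t (hpos t) (p := fun q => |regression P t q.1| ≤ C)
    (measurable_fst hS) ?_
  have h1 : ∀ᵐ q ∂((P.map fun u => (covX u, treat u)) ⊗ₘ
      condDistrib outcome (fun u => (covX u, treat u)) P), |q.2| ≤ C := by
    rw [compProd_map_condDistrib measurable_outcome.aemeasurable]
    exact (ae_map_iff (hXT.prodMk measurable_outcome).aemeasurable
      (measurableSet_le (by fun_prop) measurable_const)).2 hC
  have h2 := ae_of_ae_map hXT.aemeasurable (Measure.ae_ae_of_ae_compProd h1)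
  filter_upwards [h2] with u hu ht
  have := norm_integral_le_of_norm_le_const (f := fun y : ℝ => y) hu
  rw [ht] at this
  simpa [regression] using this

/-- The conditional average treatment effect, tested against functions of the covariates. -/
lemma integral_mul_cate {C : ℝ} (hC : ∀ t, ∀ᵐ u ∂P, |pot t u| ≤ C) {h : Cov d → ℝ}
    (hm : Measurable h) (hi : Integrable h (covLaw P)) :
    ∫ x, h x * cate P x ∂(covLaw P) = ∫ u, h (covX u) * (pot1 u - pot0 u) ∂P := by
  have hD : ∀ᵐ u ∂P, ‖pot1 u - pot0 u‖ ≤ C + C := by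
    filter_upwards [hC true, hC false] with u h1 h0
    exact (norm_sub_le _ _).trans (add_le_add h1 h0)
  have hDi : Integrable (fun u => pot1 u - pot0 u) P :=
    Integrable.of_bound (Measurable.aestronglyMeasurable (by fun_prop)) _ hD
  have hhX : Integrable (fun u => h (covX u)) P :=
    hi.comp_measurable measurable_covX
  have hprod : Integrable (fun u => h (covX u) * (pot1 u - pot0 u)) P :=
    hhX.mul_bdd (Measurable.aestronglyMeasurable (by fun_prop)) hD
  have hce := condExp_ae_eq_integral_condDistrib' measurable_covX hDi
  have hsm : StronglyMeasurable[MeasurableSpace.comap (covX (d := d)) inferInstance]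
      fun u => h (covX u) :=
    hm.stronglyMeasurable.comp_measurable (comap_measurable _)
  have hpull := condExp_mul_of_stronglyMeasurable_left hsm hprod hDi
  rw [covLaw, integral_map measurable_covX.aemeasurable
    (Measurable.aestronglyMeasurable (by fun_prop)),
    ← integral_condExp measurable_covX.comap_le (f := fun u => h (covX u) * (pot1 u - pot0 u))]
  refine integral_congr_ae ?_
  filter_upwards [hce, hpull] with u h1 h2
  rw [cate, ← h1]
  exact h2.symm

lemma ae_abs_cate_le {C : ℝ} (hC : ∀ t, ∀ᵐ u ∂P, |pot t u| ≤ C) :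
    ∀ᵐ x ∂(covLaw P), |cate P x| ≤ C + C := by
  have h1 : ∀ᵐ q ∂((P.map covX) ⊗ₘ condDistrib (fun u => pot1 u - pot0 u) covX P),
      |q.2| ≤ C + C := by
    rw [compProd_map_condDistrib (by fun_prop)]
    refine (ae_map_iff (by fun_prop) (measurableSet_le (by fun_prop) measurable_const)).2 ?_
    filter_upwards [hC true, hC false] with u h1 h0
    exact (abs_sub _ _).trans (add_le_add h1 h0)
  filter_upwards [Measure.ae_ae_of_ae_compProd h1] with x hx
  simpa [cate] using norm_integral_le_of_norm_le_const (f := fun y : ℝ => y) hx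

end Population

section Score

variable {d : ℕ}

/-! ### The score with the true nuisances -/

/-- The true nuisance functions. -/
noncomputable def oracle (P : Measure (Full d)) [IsProbabilityMeasure P] : Nuisance d where
  mu := regression P
  e := propensity P

/-- The observed data point of a unit. -/
def obsOf (u : Full d) : Obs d := (covX u, treat u, outcome u)

@[fun_prop]
lemma measurable_obsOf : Measurable (obsOf (d := d)) := by unfold obsOf; fun_prop

/-- The score is jointly measurable in the data point and a parameter of the nuisances. -/
lemma measurable_score {Ω : Type*} [MeasurableSpace Ω] {N : Ω → Nuisance d}
    (hmu : ∀ t, Measurable fun p : Ω × Cov d => (N p.1).mu t p.2)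
    (he : Measurable fun p : Ω × Cov d => (N p.1).e p.2)
    {f g : Cov d → ℝ} (hf : Measurable f) (hg : Measurable g) :
    Measurable fun p : Ω × Obs d => score (N p.1) f g p.2 := by
  have hq : Measurable fun p : Ω × Obs d => (p.1, p.2.1) := by fun_prop
  have h1 := (hmu true).comp hq
  have h0 := (hmu false).comp hq
  have h2 := he.comp hq
  have hw : Measurable fun p : Ω × Obs d => if p.2.2.1 then (1 : ℝ) else 0 :=
    Measurable.ite ((measurable_fst.comp (measurable_snd.comp measurable_snd))
      (measurableSet_singleton true)) measurable_const measurable_const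
  simp only [Function.comp_def] at h1 h0 h2
  change Measurable fun p : Ω × Obs d => (f p.2.1 ^ 2 - g p.2.1 ^ 2) -
    2 * (f p.2.1 - g p.2.1) *
    ((if p.2.2.1 then (1 : ℝ) else 0) * (p.2.2.2 - (N p.1).mu true p.2.1) / (N p.1).e p.2.1
      + (N p.1).mu true p.2.1
      - (1 - if p.2.2.1 then (1 : ℝ) else 0) * (p.2.2.2 - (N p.1).mu false p.2.1)
        / (1 - (N p.1).e p.2.1) - (N p.1).mu false p.2.1)
  fun_prop

lemma measurable_score_oracle (P : Measure (Full d)) [IsProbabilityMeasure P]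
    {f g : Cov d → ℝ} (hf : Measurable f) (hg : Measurable g) :
    Measurable (score (oracle P) f g) :=
  (measurable_score (N := fun _ : Unit => oracle P)
    (fun t => (measurable_regression P t).comp measurable_snd)
    ((measurable_propensity P).comp measurable_snd) hf hg).comp
      (by fun_prop : Measurable fun o : Obs d => ((), o))

variable {P : Measure (Full d)} [IsProbabilityMeasure P]

/-- The inverse-probability-weighted residual of the arm `t`. -/
noncomputable def ipwResidual (P : Measure (Full d)) [IsProbabilityMeasure P] (t : Bool) :
    Full d → ℝ :=
  {u | treat u = t}.indicator fun u =>
    (pot t u - regression P t (covX u)) / armProb P t (covX u)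

lemma measurable_ipwResidual (t : Bool) : Measurable (ipwResidual P t) :=
  Measurable.indicator (by fun_prop) (measurableSet_treat t)

lemma score_oracle_obsOf (f g : Cov d → ℝ) (u : Full d) :
    score (oracle P) f g (obsOf u) = (f (covX u) ^ 2 - g (covX u) ^ 2) -
      2 * (f (covX u) - g (covX u)) * (ipwResidual P true u + regression P true (covX u)
        - ipwResidual P false u - regression P false (covX u)) := by
  cases h : treat u <;>
    simp [score, oracle, obsOf, ipwResidual, Set.indicator, h, outcome_eq_pot, armProb_true,
      armProb_false]

lemma ae_abs_ipwResidual_le {η C : ℝ} (hη : 0 < η)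
    (hov : ∀ᵐ x ∂(covLaw P), η < propensity P x ∧ propensity P x < 1 - η)
    (hpot : ∀ t, ∀ᵐ u ∂P, |pot t u| ≤ C)
    (hreg : ∀ t, ∀ᵐ x ∂(covLaw P), |regression P t x| ≤ C) (t : Bool) :
    ∀ᵐ u ∂P, |ipwResidual P t u| ≤ (C + C) / η := by
  filter_upwards [hpot t, ae_of_ae_map measurable_covX.aemeasurable (hreg t),
    ae_of_ae_map measurable_covX.aemeasurable hov] with u h1 h2 h3
  have hCC : 0 ≤ C + C := by linarith [abs_nonneg (pot t u)]
  have hp : η ≤ armProb P t (covX u) := by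
    cases t
    · rw [armProb_false]; linarith
    · rw [armProb_true]; linarith
  by_cases hu : treat u = t
  · rw [ipwResidual, Set.indicator_of_mem (show u ∈ {u | treat u = t} from hu), abs_div,
      abs_of_pos (hη.trans_le hp)]
    exact div_le_div₀ hCC ((abs_sub _ _).trans (add_le_add h1 h2)) hη hp
  · rw [ipwResidual, Set.indicator_of_notMem (show u ∉ {u | treat u = t} from hu), abs_zero]
    positivity

lemma integral_mul_ipwResidual (hunc : Unconfounded P) (t : Bool)
    (hpos : ∀ᵐ x ∂(covLaw P), 0 < armProb P t x) {h : Cov d → ℝ} (hm : Measurable h) :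
    ∫ u, h (covX u) * ipwResidual P t u ∂P =
      ∫ u, h (covX u) * (pot t u - regression P t (covX u)) ∂P := by
  have h1 : ∀ u, h (covX u) * ipwResidual P t u = {u | treat u = t}.indicator (fun u =>
      h (covX u) * ((pot t u - regression P t (covX u)) / armProb P t (covX u))) u := by
    intro u
    by_cases hu : treat u = t <;> simp [ipwResidual, Set.indicator, hu]
  simp_rw [h1]
  rw [integral_indicator (measurableSet_treat t)]
  refine (setIntegral_treat hunc t (φ := fun q => h q.1 * (((if t then q.2.2 else q.2.1)
    - regression P t q.1) / armProb P t q.1)) ?_).trans (integral_congr_ae ?_)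
  · cases t <;> simp <;> fun_prop
  · filter_upwards [ae_of_ae_map measurable_covX.aemeasurable hpos] with u hu
    simp only [pot]
    field_simp

/-- The augmented inverse-probability-weighted score identifies the relative error. -/
lemma integrable_score_oracle_and_integral_eq (hunc : Unconfounded P) {η C : ℝ} (hη : 0 < η)
    (hov : ∀ᵐ x ∂(covLaw P), η < propensity P x ∧ propensity P x < 1 - η)
    (hpot : ∀ t, ∀ᵐ u ∂P, |pot t u| ≤ C)
    (hreg : ∀ t, ∀ᵐ x ∂(covLaw P), |regression P t x| ≤ C)
    {f g : Cov d → ℝ} (hf : Measurable f) (hg : Measurable g)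
    (hf2 : MemLp f 2 (covLaw P)) (hg2 : MemLp g 2 (covLaw P)) :
    Integrable (score (oracle P) f g) (obsLaw P) ∧
      ∫ o, score (oracle P) f g o ∂(obsLaw P) = relErr P f g := by
  have hpos := ae_armProb_pos hη hov
  have hX := measurable_covX (d := d)
  have hfg : Integrable (fun x => f x - g x) (covLaw P) := (hf2.sub hg2).integrable (by simp)
  have hfgX : Integrable (fun u => f (covX u) - g (covX u)) P := hfg.comp_measurable hX
  have hf2X : Integrable (fun u => f (covX u) ^ 2) P := hf2.integrable_sq.comp_measurable hX
  have hg2X : Integrable (fun u => g (covX u) ^ 2) P := hg2.integrable_sq.comp_measurable hX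
  have hI (t : Bool) : Integrable (fun u => (f (covX u) - g (covX u)) * ipwResidual P t u) P :=
    hfgX.mul_bdd (measurable_ipwResidual t).aestronglyMeasurable
      (ae_abs_ipwResidual_le hη hov hpot hreg t)
  have hR (t : Bool) :
      Integrable (fun u => (f (covX u) - g (covX u)) * regression P t (covX u)) P :=
    hfgX.mul_bdd (Measurable.aestronglyMeasurable (by fun_prop))
      (ae_of_ae_map hX.aemeasurable (hreg t))
  have hQ (t : Bool) : Integrable (fun u => (f (covX u) - g (covX u)) * pot t u) P :=
    hfgX.mul_bdd (Measurable.aestronglyMeasurable (by fun_prop)) (hpot t)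
  have hIint (t : Bool) : ∫ u, (f (covX u) - g (covX u)) * ipwResidual P t u ∂P =
      ∫ u, (f (covX u) - g (covX u)) * pot t u ∂P
        - ∫ u, (f (covX u) - g (covX u)) * regression P t (covX u) ∂P := by
    rw [integral_mul_ipwResidual hunc t (hpos t) (h := fun x => f x - g x) (by fun_prop),
      ← integral_sub (hQ t) (hR t)]
    simp_rw [mul_sub]
  have hsplit : (fun u => score (oracle P) f g (obsOf u)) = fun u =>
      (f (covX u) ^ 2 - g (covX u) ^ 2) -
      2 * (((f (covX u) - g (covX u)) * ipwResidual P true u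
        + (f (covX u) - g (covX u)) * regression P true (covX u))
        - ((f (covX u) - g (covX u)) * ipwResidual P false u
        + (f (covX u) - g (covX u)) * regression P false (covX u))) := by
    ext u; rw [score_oracle_obsOf]; ring
  have hIR (t : Bool) : Integrable (fun u => (f (covX u) - g (covX u)) * ipwResidual P t u
      + (f (covX u) - g (covX u)) * regression P t (covX u)) P := (hI t).add (hR t)
  have hIRR : Integrable (fun u => 2 * (((f (covX u) - g (covX u)) * ipwResidual P true u
        + (f (covX u) - g (covX u)) * regression P true (covX u))
        - ((f (covX u) - g (covX u)) * ipwResidual P false u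
        + (f (covX u) - g (covX u)) * regression P false (covX u)))) P :=
    ((hIR true).sub (hIR false)).const_mul 2
  have hfgX2 : Integrable (fun u => f (covX u) ^ 2 - g (covX u) ^ 2) P := hf2X.sub hg2X
  have hint : Integrable (fun u => score (oracle P) f g (obsOf u)) P := by
    rw [hsplit]
    exact hfgX2.sub hIRR
  have hms := measurable_score_oracle P hf hg
  refine ⟨(integrable_map_measure hms.aestronglyMeasurable
    measurable_obsOf.aemeasurable).2 hint, ?_⟩
  have h1 : ∫ o, score (oracle P) f g o ∂(obsLaw P) =
      ∫ u, score (oracle P) f g (obsOf u) ∂P :=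
    integral_map measurable_obsOf.aemeasurable hms.aestronglyMeasurable
  have h2 : ∫ u, score (oracle P) f g (obsOf u) ∂P =
      (∫ u, f (covX u) ^ 2 ∂P - ∫ u, g (covX u) ^ 2 ∂P) -
        2 * (∫ u, (f (covX u) - g (covX u)) * pot true u ∂P
          - ∫ u, (f (covX u) - g (covX u)) * pot false u ∂P) := by
    rw [hsplit, integral_sub hfgX2 hIRR, integral_sub hf2X hg2X, integral_const_mul,
      integral_sub (hIR true) (hIR false),
      integral_add (hI true) (hR true), integral_add (hI false) (hR false), hIint, hIint]
    ring
  have hc := ae_abs_cate_le hpot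
  have hcm : AEStronglyMeasurable (cate P) (covLaw P) := (measurable_cate P).aestronglyMeasurable
  have hc2 : MemLp (cate P) 2 (covLaw P) := MemLp.of_bound hcm _ hc
  have h3 : relErr P f g = (∫ x, f x ^ 2 ∂(covLaw P) - ∫ x, g x ^ 2 ∂(covLaw P)) -
      2 * ∫ x, (f x - g x) * cate P x ∂(covLaw P) := by
    have hfc : Integrable (fun x => (f x - cate P x) ^ 2) (covLaw P) :=
      (hf2.sub hc2).integrable_sq
    have hgc : Integrable (fun x => (g x - cate P x) ^ 2) (covLaw P) :=
      (hg2.sub hc2).integrable_sq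
    have hfg2 : Integrable (fun x => f x ^ 2 - g x ^ 2) (covLaw P) :=
      hf2.integrable_sq.sub hg2.integrable_sq
    have hfgc : Integrable (fun x => 2 * ((f x - g x) * cate P x)) (covLaw P) :=
      (hfg.mul_bdd hcm hc).const_mul 2
    rw [relErr, risk, risk, ← integral_sub hfc hgc,
      ← integral_sub hf2.integrable_sq hg2.integrable_sq, ← integral_const_mul,
      ← integral_sub hfg2 hfgc]
    congr 1 with x
    ring
  have h4 := integral_mul_cate hpot (h := fun x => f x - g x) (by fun_prop) hfg
  have h5 : ∫ u, (f (covX u) - g (covX u)) * (pot1 u - pot0 u) ∂P =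
      ∫ u, (f (covX u) - g (covX u)) * pot true u ∂P
          - ∫ u, (f (covX u) - g (covX u)) * pot false u ∂P := by
    rw [← integral_sub (hQ true) (hQ false)]
    simp_rw [← mul_sub]
    rfl
  rw [h1, h2, h3, h4, h5, covLaw, integral_map hX.aemeasurable
    (Measurable.aestronglyMeasurable (by fun_prop)), integral_map hX.aemeasurable
    (Measurable.aestronglyMeasurable (by fun_prop))]

/-! ### Stability of the score in the nuisances -/

lemma abs_weighted_residual_sub_le {y m m' p p' η η' K : ℝ} (hη : 0 < η) (hη' : 0 < η')
    (hp : η < p) (hp' : η' < p') (hK : |y - m| ≤ K) :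
    |(y - m') / p' - (y - m) / p| ≤ |m' - m| / η' + K / (η' * η) * |p' - p| := by
  have hp0 : 0 < p := hη.trans hp
  have hp0' : 0 < p' := hη'.trans hp'
  have hK0 : 0 ≤ K := (abs_nonneg _).trans hK
  have h : (y - m') / p' - (y - m) / p = (m - m') / p' + (y - m) / (p' * p) * (p - p') := by
    field_simp
    ring
  rw [h]
  refine (abs_add_le _ _).trans (add_le_add ?_ ?_)
  · rw [abs_div, abs_of_pos hp0', abs_sub_comm]
    gcongr
  · rw [abs_mul, abs_div, abs_of_pos (mul_pos hp0' hp0), abs_sub_comm p]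
    gcongr

/-- Where the propensity scores are bounded away from `0` and `1` and the residual is bounded, the
score is Lipschitz in the nuisances. -/
lemma abs_score_sub_le {N N' : Nuisance d} {η η' K : ℝ} (hη : 0 < η) (hη' : 0 < η')
    (f g : Cov d → ℝ) {o : Obs d} (he : η < N.e o.1 ∧ N.e o.1 < 1 - η)
    (he' : η' < N'.e o.1 ∧ N'.e o.1 < 1 - η') (hK : ∀ t, |o.2.2 - N.mu t o.1| ≤ K) :
    |score N' f g o - score N f g o| ≤ 2 * (1 + 1 / η' + K / (η' * η)) *
      (|f o.1 - g o.1| * (|N'.mu true o.1 - N.mu true o.1| +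
        |N'.mu false o.1 - N.mu false o.1| + |N'.e o.1 - N.e o.1|)) := by
  obtain ⟨x, t, y⟩ := o
  have hK0 : 0 ≤ K := (abs_nonneg _).trans (hK true)
  simp only at he he' hK ⊢
  set a := |N'.mu true x - N.mu true x| with ha
  set b := |N'.mu false x - N.mu false x| with hb
  set c := |N'.e x - N.e x| with hc
  have ha0 : 0 ≤ a := abs_nonneg _
  have hb0 : 0 ≤ b := abs_nonneg _
  have hc0 : 0 ≤ c := abs_nonneg _
  have h1 : 0 ≤ 1 / η' := by positivity
  have h2 : 0 ≤ K / (η' * η) := by positivity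
  suffices h : ∃ r, score N' f g (x, t, y) - score N f g (x, t, y) = -2 * (f x - g x) * r ∧
      |r| ≤ (1 + 1 / η' + K / (η' * η)) * (a + b + c) by
    obtain ⟨r, hr, hr'⟩ := h
    rw [hr, abs_mul, abs_mul, abs_neg, abs_two]
    calc 2 * |f x - g x| * |r|
        ≤ 2 * |f x - g x| * ((1 + 1 / η' + K / (η' * η)) * (a + b + c)) := by gcongr
      _ = _ := by ring
  have hab : |N'.mu true x - N.mu true x - (N'.mu false x - N.mu false x)| ≤ a + b := abs_sub _ _
  cases t
  · have h3 := abs_weighted_residual_sub_le (m' := N'.mu false x) hη hη'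
      (by linarith : η < 1 - N.e x) (by linarith : η' < 1 - N'.e x) (hK false)
    rw [show 1 - N'.e x - (1 - N.e x) = -(N'.e x - N.e x) by ring, abs_neg, ← hb, ← hc] at h3
    refine ⟨(N'.mu true x - N.mu true x - (N'.mu false x - N.mu false x)) -
      ((y - N'.mu false x) / (1 - N'.e x) - (y - N.mu false x) / (1 - N.e x)), ?_, ?_⟩
    · simp [score]; ring
    · refine (abs_sub _ _).trans ((add_le_add hab h3).trans ?_)
      rw [div_eq_mul_one_div b]
      nlinarith [mul_nonneg h1 ha0, mul_nonneg h1 hc0, mul_nonneg h2 ha0, mul_nonneg h2 hb0]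
  · have h3 := abs_weighted_residual_sub_le (m' := N'.mu true x) hη hη' he.1 he'.1 (hK true)
    rw [← ha, ← hc] at h3
    refine ⟨(N'.mu true x - N.mu true x - (N'.mu false x - N.mu false x)) +
      ((y - N'.mu true x) / N'.e x - (y - N.mu true x) / N.e x), ?_, ?_⟩
    · simp [score]; ring
    · refine (abs_add_le _ _).trans ((add_le_add hab h3).trans ?_)
      rw [div_eq_mul_one_div a]
      nlinarith [mul_nonneg h1 hb0, mul_nonneg h1 hc0, mul_nonneg h2 ha0, mul_nonneg h2 hb0]

/-- The mean absolute error of the score is at most a constant times the sum of the `L²` errors of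
the nuisances. -/
lemma lintegral_score_sub_oracle_le {η η' C : ℝ} (hη : 0 < η) (hη' : 0 < η')
    (hov : ∀ᵐ x ∂(covLaw P), η < propensity P x ∧ propensity P x < 1 - η)
    (hout : ∀ᵐ u ∂P, |outcome u| ≤ C)
    (hreg : ∀ t, ∀ᵐ x ∂(covLaw P), |regression P t x| ≤ C)
    {f g : Cov d → ℝ} (hf : Measurable f) (hg : Measurable g) {N : Nuisance d}
    (hmu : ∀ t, Measurable (N.mu t)) (he : Measurable N.e)
    (hov' : ∀ᵐ x ∂(covLaw P), η' < N.e x ∧ N.e x < 1 - η') :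
    ∫⁻ o, ‖score N f g o - score (oracle P) f g o‖ₑ ∂(obsLaw P) ≤
      ENNReal.ofReal (2 * (1 + 1 / η' + (C + C) / (η' * η))) *
        (eLpNorm (fun x => f x - g x) 2 (covLaw P) *
          (eLpNorm (fun x => N.mu true x - regression P true x) 2 (covLaw P) +
          eLpNorm (fun x => N.mu false x - regression P false x) 2 (covLaw P) +
          eLpNorm (fun x => N.e x - propensity P x) 2 (covLaw P))) := by
  set c : ℝ := 2 * (1 + 1 / η' + (C + C) / (η' * η)) with hc
  have hC : 0 ≤ C := by
    obtain ⟨u, hu⟩ := hout.exists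
    exact (abs_nonneg _).trans hu
  have hX := measurable_covX (d := d)
  have hN : Measurable (score N f g) :=
    (measurable_score (N := fun _ : Unit => N) (fun t => (hmu t).comp measurable_snd)
      (he.comp measurable_snd) hf hg).comp (by fun_prop : Measurable fun o : Obs d => ((), o))
  have hO := measurable_score_oracle P hf hg
  set D : Cov d → ℝ := fun x => |N.mu true x - regression P true x| +
    |N.mu false x - regression P false x| + |N.e x - propensity P x| with hD
  have hDm : Measurable D := by fun_prop
  have hpt : ∀ᵐ u ∂P, ‖score N f g (obsOf u) - score (oracle P) f g (obsOf u)‖ₑ ≤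
      ENNReal.ofReal c * ‖(f (covX u) - g (covX u)) * D (covX u)‖ₑ := by
    filter_upwards [hout, ae_of_ae_map hX.aemeasurable hov, ae_of_ae_map hX.aemeasurable hov',
      ae_of_ae_map hX.aemeasurable (hreg true), ae_of_ae_map hX.aemeasurable (hreg false)]
      with u h1 h2 h3 h4 h5
    have := abs_score_sub_le (N := oracle P) (N' := N) (o := obsOf u) (K := C + C) hη hη' f g h2 h3
      (by rintro (_ | _)
          · exact (abs_sub _ _).trans (add_le_add h1 h5)
          · exact (abs_sub _ _).trans (add_le_add h1 h4))
    have hD0 : 0 ≤ D (covX u) := by positivity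
    rw [← ofReal_norm, ← ofReal_norm, ← ENNReal.ofReal_mul (by positivity)]
    refine ENNReal.ofReal_le_ofReal ?_
    rw [Real.norm_eq_abs, Real.norm_eq_abs, abs_mul, abs_of_nonneg hD0]
    exact this
  calc ∫⁻ o, ‖score N f g o - score (oracle P) f g o‖ₑ ∂(obsLaw P)
      = ∫⁻ u, ‖score N f g (obsOf u) - score (oracle P) f g (obsOf u)‖ₑ ∂P :=
        lintegral_map (hN.sub hO).enorm measurable_obsOf
    _ ≤ ∫⁻ u, ENNReal.ofReal c * ‖(f (covX u) - g (covX u)) * D (covX u)‖ₑ ∂P :=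
        lintegral_mono_ae hpt
    _ = ENNReal.ofReal c * ∫⁻ u, ‖(f (covX u) - g (covX u)) * D (covX u)‖ₑ ∂P :=
        lintegral_const_mul _ (by fun_prop)
    _ = ENNReal.ofReal c * eLpNorm ((fun x => f x - g x) • D) 1 (covLaw P) := by
        rw [eLpNorm_one_eq_lintegral_enorm, covLaw, lintegral_map (by fun_prop) hX]
        rfl
    _ ≤ _ := by
        refine mul_le_mul_right ?_ _
        refine (eLpNorm_smul_le_mul_eLpNorm (p := 2) (q := 2) hDm.aestronglyMeasurable
          (hf.sub hg).aestronglyMeasurable).trans ?_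
        refine mul_le_mul_right ?_ _
        have ha (t : Bool) : AEStronglyMeasurable (fun x => |N.mu t x - regression P t x|)
            (covLaw P) := Measurable.aestronglyMeasurable (by fun_prop)
        have hb : AEStronglyMeasurable (fun x => |N.e x - propensity P x|) (covLaw P) :=
          Measurable.aestronglyMeasurable (by fun_prop)
        refine (eLpNorm_add_le ((ha true).add (ha false)) hb one_le_two).trans ?_
        refine add_le_add ((eLpNorm_add_le (ha true) (ha false) one_le_two).trans
          (add_le_add ?_ ?_)) ?_
        · exact (eLpNorm_norm fun x => N.mu true x - regression P true x).le
        · exact (eLpNorm_norm fun x => N.mu false x - regression P false x).le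
        · exact (eLpNorm_norm fun x => N.e x - propensity P x).le

end Score

section Sample

variable {d : ℕ} {P : Measure (Full d)}

/-! ### Events of probability tending to one -/

/-- The event `p n` of the test sample of size `n` has probability tending to one. The events need
not be measurable: it is the outer measure of the complement that tends to zero. -/
def WithHighProb (P : Measure (Full d)) (p : ∀ n, (Fin n → Obs d) → Prop) : Prop :=
  Tendsto (fun n => sampleLaw P n {z | ¬ p n z}) atTop (𝓝 0)

namespace WithHighProb

variable {p q : ∀ n, (Fin n → Obs d) → Prop}

lemma mono_eventually (hp : WithHighProb P p) (h : ∀ᶠ n in atTop, ∀ z, p n z → q n z) :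
    WithHighProb P q := by
  refine tendsto_of_tendsto_of_tendsto_of_le_of_le' tendsto_const_nhds hp
    (Eventually.of_forall fun _ => zero_le) ?_
  filter_upwards [h] with n hn
  exact measure_mono fun z hz hpz => hz (hn z hpz)

lemma mono (hp : WithHighProb P p) (h : ∀ n z, p n z → q n z) : WithHighProb P q :=
  hp.mono_eventually (Eventually.of_forall h)

lemma and (hp : WithHighProb P p) (hq : WithHighProb P q) :
    WithHighProb P fun n z => p n z ∧ q n z := by
  have h := hp.add hq
  rw [add_zero] at h
  refine tendsto_of_tendsto_of_tendsto_of_le_of_le tendsto_const_nhds h (fun _ => zero_le) ?_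
  intro n
  refine (measure_mono ?_).trans (measure_union_le _ _)
  intro z hz
  by_cases hpz : p n z
  · exact Or.inr fun hqz => hz ⟨hpz, hqz⟩
  · exact Or.inl hpz

lemma forall_finite {ι : Type*} [Finite ι] {p : ι → ∀ n, (Fin n → Obs d) → Prop}
    (hp : ∀ i, WithHighProb P (p i)) : WithHighProb P fun n z => ∀ i, p i n z := by
  have := Fintype.ofFinite ι
  have h := tendsto_finsetSum Finset.univ fun i _ => hp i
  rw [Finset.sum_const_zero] at h
  refine tendsto_of_tendsto_of_tendsto_of_le_of_le tendsto_const_nhds h (fun _ => zero_le) ?_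
  intro n
  refine (measure_mono ?_).trans (measure_iUnion_fintype_le _ _)
  intro z hz
  obtain ⟨i, hi⟩ := not_forall.1 hz
  exact Set.mem_iUnion.2 ⟨i, hi⟩

/-- It suffices to bound the probability of failure by any `κ > 0` on events of probability tending
to one. -/
lemma of_forall_le
    (h : ∀ κ : ℝ, 0 < κ → ∃ g : ∀ n, (Fin n → Obs d) → Prop, WithHighProb P g ∧
      ∀ᶠ n in atTop, sampleLaw P n ({z | g n z} ∩ {z | ¬ p n z}) ≤ ENNReal.ofReal κ) :
    WithHighProb P p := by
  refine ENNReal.tendsto_nhds_zero.2 fun ε hε => ?_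
  obtain ⟨κ, -, hκ0, hκ⟩ := ENNReal.lt_iff_exists_real_btwn.1 (ENNReal.half_pos hε.ne')
  obtain ⟨g, hg, hle⟩ := h κ (ENNReal.ofReal_pos.1 hκ0)
  filter_upwards [hle, ENNReal.tendsto_nhds_zero.1 hg (ε / 2) (ENNReal.half_pos hε.ne')]
    with n h1 h2
  calc sampleLaw P n {z | ¬ p n z}
      ≤ sampleLaw P n ({z | ¬ g n z} ∪ ({z | g n z} ∩ {z | ¬ p n z})) := by
        refine measure_mono fun z hz => ?_
        by_cases hgz : g n z
        · exact Or.inr ⟨hgz, hz⟩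
        · exact Or.inl hgz
    _ ≤ ε / 2 + ε / 2 := (measure_union_le _ _).trans (add_le_add h2 (h1.trans hκ.le))
    _ = ε := ENNReal.add_halves ε

end WithHighProb

/-- Markov's inequality for an average over `s`, on an event `G`. -/
lemma measure_inter_lt_sum_abs_le {Ω ι : Type*} [MeasurableSpace Ω] (μ : Measure Ω)
    (s : Finset ι) {r : ι → Ω → ℝ} (hr : ∀ i ∈ s, Measurable (r i)) {G : Set Ω} {κ ε : ℝ}
    (hκ : 0 < κ) (hε : 0 < ε)
    (h : ∀ i ∈ s, ∫⁻ z in G, ‖r i z‖ₑ ∂μ ≤ ENNReal.ofReal (κ * ε)) :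
    μ (G ∩ {z | ¬ ∑ i ∈ s, |r i z| ≤ ε * s.card}) ≤ ENNReal.ofReal κ := by
  rcases s.eq_empty_or_nonempty with rfl | hs
  · simp
  have hcard : (0 : ℝ) < s.card := by exact_mod_cast hs.card_pos
  have hm : Measurable fun z => ∑ i ∈ s, ‖r i z‖ₑ :=
    Finset.measurable_fun_sum _ fun i hi => (hr i hi).enorm
  have hpos : ENNReal.ofReal (ε * s.card) ≠ 0 := by
    rw [Ne, ENNReal.ofReal_eq_zero, not_le]; positivity
  have hsub : G ∩ {z | ¬ ∑ i ∈ s, |r i z| ≤ ε * s.card} ⊆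
      {z | ENNReal.ofReal (ε * s.card) ≤ ∑ i ∈ s, ‖r i z‖ₑ} ∩ G := by
    rintro z ⟨hzG, hz⟩
    refine ⟨?_, hzG⟩
    have : ∑ i ∈ s, ‖r i z‖ₑ = ENNReal.ofReal (∑ i ∈ s, |r i z|) := by
      rw [ENNReal.ofReal_sum_of_nonneg fun i _ => abs_nonneg _]
      simp_rw [← Real.norm_eq_abs, ofReal_norm]
    rw [Set.mem_ofPred_eq, this]
    exact ENNReal.ofReal_le_ofReal (not_le.1 hz).le
  calc μ (G ∩ {z | ¬ ∑ i ∈ s, |r i z| ≤ ε * s.card})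
      ≤ (μ.restrict G) {z | ENNReal.ofReal (ε * s.card) ≤ ∑ i ∈ s, ‖r i z‖ₑ} := by
        rw [Measure.restrict_apply (measurableSet_le measurable_const hm)]
        exact measure_mono hsub
    _ ≤ (∫⁻ z in G, ∑ i ∈ s, ‖r i z‖ₑ ∂μ) / ENNReal.ofReal (ε * s.card) :=
        meas_ge_le_lintegral_div hm.aemeasurable hpos ENNReal.ofReal_ne_top
    _ ≤ ENNReal.ofReal κ := by
        refine ENNReal.div_le_of_le_mul ?_
        rw [lintegral_finsetSum' _ fun i hi => (hr i hi).enorm.aemeasurable]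
        refine (Finset.sum_le_card_nsmul _ _ _ h).trans_eq ?_
        rw [nsmul_eq_mul, ← ENNReal.ofReal_natCast, ← ENNReal.ofReal_mul hcard.le,
          ← ENNReal.ofReal_mul hκ.le]
        congr 1
        ring

/-! ### The law of large numbers on a fold -/

/-- A function integrable under the law of one observation is, up to a small error in the mean, a
bounded measurable function. -/
lemma exists_bounded_lintegral_sub_le {h : Obs d → ℝ} (hi : Integrable h (obsLaw P)) {θ : ℝ}
    (hθ : 0 < θ) : ∃ φ : Obs d → ℝ, Measurable φ ∧ (∃ M, ∀ o, |φ o| ≤ M) ∧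
      ∫⁻ o, ‖h o - φ o‖ₑ ∂(obsLaw P) ≤ ENNReal.ofReal θ := by
  obtain ⟨φ, hφ, -⟩ := (memLp_one_iff_integrable.2 hi).exists_simpleFunc_eLpNorm_sub_lt
    (by simp) (ENNReal.ofReal_pos.2 hθ).ne'
  refine ⟨φ, φ.measurable, φ.exists_forall_norm_le, ?_⟩
  rw [eLpNorm_one_eq_lintegral_enorm] at hφ
  exact hφ.le

variable [IsProbabilityMeasure P]

lemma measurePreserving_eval_sampleLaw {n : ℕ} (i : Fin n) :
    MeasurePreserving (fun z : Fin n → Obs d => z i) (sampleLaw P n) (obsLaw P) :=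
  measurePreserving_eval (fun _ : Fin n => obsLaw P) i

/-- Chebyshev's inequality on a fold. -/
lemma withHighProb_abs_sum_sub_le_of_memLp {φ : Obs d → ℝ} (hφ : MemLp φ 2 (obsLaw P))
    {A : (n : ℕ) → Finset (Fin n)} (hA : Tendsto (fun n => ((A n).card : ℝ)) atTop atTop) {ε : ℝ}
    (hε : 0 < ε) :
    WithHighProb P fun n z =>
      |∑ i ∈ A n, φ (z i) - (A n).card * ∫ o, φ o ∂(obsLaw P)| ≤ ε * (A n).card := by
  have hlim : Tendsto (fun n => ENNReal.ofReal (Var[φ; obsLaw P] / ε ^ 2 / (A n).card)) atTop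
      (𝓝 0) := by
    rw [← ENNReal.ofReal_zero]
    exact ENNReal.tendsto_ofReal (hA.const_div_atTop _)
  refine tendsto_of_tendsto_of_tendsto_of_le_of_le' tendsto_const_nhds hlim
    (Eventually.of_forall fun _ => zero_le) ?_
  filter_upwards [hA.eventually_gt_atTop 0] with n hn
  have hev (i : Fin n) := measurePreserving_eval_sampleLaw (P := P) i
  have hmem (i : Fin n) : MemLp (fun z : Fin n → Obs d => φ (z i)) 2 (sampleLaw P n) :=
    hφ.comp_measurePreserving (hev i)
  have hvar : Var[∑ i ∈ A n, fun z : Fin n → Obs d => φ (z i); sampleLaw P n] =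
      (A n).card * Var[φ; obsLaw P] := by
    rw [IndepFun.variance_sum (fun i _ => hmem i)]
    · have hi (i : Fin n) : Var[fun z : Fin n → Obs d => φ (z i); sampleLaw P n] =
          Var[φ; obsLaw P] := by
        change Var[φ ∘ (fun z : Fin n → Obs d => z i); sampleLaw P n] = _
        rw [← variance_map _ (hev i).measurable.aemeasurable, (hev i).map_eq]
        rw [(hev i).map_eq]
        exact hφ.aestronglyMeasurable.aemeasurable
      simp [hi]
    · exact fun i _ j _ hij =>
        (iIndepFun_pi fun i => hφ.aestronglyMeasurable.aemeasurable).indepFun hij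
  have hmean : ∫ z, (∑ i ∈ A n, fun z : Fin n → Obs d => φ (z i)) z ∂(sampleLaw P n) =
      (A n).card * ∫ o, φ o ∂(obsLaw P) := by
    simp only [Finset.sum_apply]
    rw [integral_finsetSum _ fun i _ => (hmem i).integrable one_le_two]
    have hi (i : Fin n) : ∫ z, φ (z i) ∂(sampleLaw P n) = ∫ o, φ o ∂(obsLaw P) := by
      rw [← (hev i).map_eq, integral_map (hev i).measurable.aemeasurable]
      rw [(hev i).map_eq]
      exact hφ.aestronglyMeasurable
    simp [hi]
  have hch := meas_ge_le_variance_div_sq (μ := sampleLaw P n)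
    (X := ∑ i ∈ A n, fun z : Fin n → Obs d => φ (z i))
    (memLp_finsetSum' _ fun i _ => hmem i) (mul_pos hε hn)
  rw [hmean, hvar] at hch
  refine (measure_mono ?_).trans (hch.trans_eq ?_)
  · intro z hz
    simpa using (not_le.1 hz).le
  · congr 1
    field_simp

lemma lintegral_eval_sampleLaw {n : ℕ} (i : Fin n) {ψ : Obs d → ℝ≥0∞} (hψ : Measurable ψ) :
    ∫⁻ z, ψ (z i) ∂(sampleLaw P n) = ∫⁻ o, ψ o ∂(obsLaw P) :=
  (measurePreserving_eval_sampleLaw i).lintegral_comp hψ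

/-- The weak law of large numbers on a fold. -/
lemma withHighProb_abs_sum_sub_le {h : Obs d → ℝ} (hm : Measurable h)
    (hi : Integrable h (obsLaw P)) {A : (n : ℕ) → Finset (Fin n)}
    (hA : Tendsto (fun n => ((A n).card : ℝ)) atTop atTop) {ε : ℝ} (hε : 0 < ε) :
    WithHighProb P fun n z =>
      |∑ i ∈ A n, h (z i) - (A n).card * ∫ o, h o ∂(obsLaw P)| ≤ ε * (A n).card := by
  refine WithHighProb.of_forall_le fun κ hκ => ?_
  obtain ⟨φ, hφm, ⟨M, hM⟩, hφ⟩ := exists_bounded_lintegral_sub_le hi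
    (θ := min (κ * (ε / 3)) (ε / 3)) (by positivity)
  have hφ2 : MemLp φ 2 (obsLaw P) :=
    MemLp.of_bound hφm.aestronglyMeasurable M (Eventually.of_forall hM)
  have hφi := hφ2.integrable one_le_two
  refine ⟨_, withHighProb_abs_sum_sub_le_of_memLp hφ2 hA (ε := ε / 3) (by positivity),
    Eventually.of_forall fun n => ?_⟩
  refine (measure_mono ?_).trans (measure_inter_lt_sum_abs_le (sampleLaw P n) (A n)
    (r := fun i z => h (z i) - φ (z i)) (fun i _ => by fun_prop) (G := Set.univ) hκ
    (ε := ε / 3) (by positivity) fun i _ => ?_)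
  · rintro z ⟨hz1, hz2⟩
    refine ⟨trivial, fun hz3 => hz2 ?_⟩
    have hmean : |∫ o, φ o ∂(obsLaw P) - ∫ o, h o ∂(obsLaw P)| ≤ ε / 3 := by
      rw [abs_sub_comm, ← integral_sub hi hφi]
      have h1 := enorm_integral_le_lintegral_enorm (μ := obsLaw P) fun o => h o - φ o
      have h2 := h1.trans (hφ.trans (ENNReal.ofReal_le_ofReal (min_le_right _ _)))
      rw [← ofReal_norm] at h2
      exact (ENNReal.ofReal_le_ofReal_iff (by positivity)).1 h2
    have h4 : |∑ i ∈ A n, h (z i) - ∑ i ∈ A n, φ (z i)| ≤ ε / 3 * (A n).card := by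
      rw [← Finset.sum_sub_distrib]
      exact (Finset.abs_sum_le_sum_abs _ _).trans hz3
    have h5 : |(A n).card * (∫ o, φ o ∂(obsLaw P) - ∫ o, h o ∂(obsLaw P))| ≤
        ε / 3 * (A n).card := by
      rw [abs_mul, Nat.abs_cast, mul_comm]
      gcongr
    simp only [Set.mem_ofPred_eq] at hz1
    rw [abs_le] at *
    constructor <;> linarith [hz1.1, hz1.2, h4.1, h4.2, h5.1, h5.2]
  · rw [Measure.restrict_univ, lintegral_eval_sampleLaw i
      (ψ := fun o => ‖h o - φ o‖ₑ) (by fun_prop)]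
    exact hφ.trans (ENNReal.ofReal_le_ofReal (min_le_left _ _))

/-- The sum of squares of an integrable function over an i.i.d. sample is `o_p(n²)`. No second
moment is needed, since `‖·‖_{ℓ²} ≤ ‖·‖_{ℓ¹}` controls the unbounded part. -/
lemma withHighProb_sum_sq_le {h : Obs d → ℝ} (hm : Measurable h)
    (hi : Integrable h (obsLaw P)) {ε : ℝ} (hε : 0 < ε) :
    WithHighProb P fun n z => ∑ i, h (z i) ^ 2 ≤ ε * (n : ℝ) ^ 2 := by
  refine WithHighProb.of_forall_le fun κ hκ => ?_
  set θ : ℝ := √ε / 2 with hθ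
  have hθ0 : 0 < θ := by positivity
  have hθ2 : 2 * θ ^ 2 = ε / 2 := by rw [hθ, div_pow, Real.sq_sqrt hε.le]; ring
  obtain ⟨φ, hφm, ⟨M, hM⟩, hφ⟩ := exists_bounded_lintegral_sub_le hi
    (θ := κ * θ) (by positivity)
  refine ⟨fun _ _ => True, by simp [WithHighProb], ?_⟩
  filter_upwards [tendsto_natCast_atTop_atTop.eventually_ge_atTop (4 * M ^ 2 / ε)] with n hn
  refine (measure_mono ?_).trans (measure_inter_lt_sum_abs_le (sampleLaw P n) Finset.univ
    (r := fun i z => h (z i) - φ (z i)) (fun i _ => by fun_prop) (G := Set.univ) hκ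
    hθ0 fun i _ => ?_)
  · rintro z ⟨-, hz2⟩
    refine ⟨trivial, fun hz3 => hz2 ?_⟩
    rw [Finset.card_univ, Fintype.card_fin] at hz3
    have h1 : ∑ i, (h (z i) - φ (z i)) ^ 2 ≤ (θ * n) ^ 2 := by
      simp_rw [← sq_abs (h _ - φ _)]
      exact (Finset.sum_sq_le_sq_sum_of_nonneg fun i _ => abs_nonneg _).trans
        (pow_le_pow_left₀ (Finset.sum_nonneg fun i _ => abs_nonneg _) hz3 2)
    have h2 : ∑ i, φ (z i) ^ 2 ≤ n * M ^ 2 := by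
      refine (Finset.sum_le_card_nsmul Finset.univ _ (M ^ 2) fun i _ => ?_).trans_eq (by simp)
      rw [← sq_abs]
      exact pow_le_pow_left₀ (abs_nonneg _) (hM _) 2
    have h3 : ∑ i, h (z i) ^ 2 ≤
        2 * ∑ i, (h (z i) - φ (z i)) ^ 2 + 2 * ∑ i, φ (z i) ^ 2 := by
      rw [Finset.mul_sum, Finset.mul_sum, ← Finset.sum_add_distrib]
      exact Finset.sum_le_sum fun i _ => by nlinarith [sq_nonneg (h (z i) - 2 * φ (z i))]
    rw [div_le_iff₀ hε] at hn
    have h4 : 4 * M ^ 2 * n ≤ n * ε * n := by gcongr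
    have h5 : 2 * (θ * n) ^ 2 = ε / 2 * (n : ℝ) ^ 2 := by rw [mul_pow, ← mul_assoc, hθ2]
    nlinarith
  · rw [Measure.restrict_univ, lintegral_eval_sampleLaw i
      (ψ := fun o => ‖h o - φ o‖ₑ) (by fun_prop)]
    exact hφ

end Sample

section CrossFitting

variable {d : ℕ} {P : Measure (Full d)} [IsProbabilityMeasure P]

/-! ### Cross-fitting -/

/-- The data of a fold `S` and an observation outside `S` are independent. -/
lemma lintegral_restrict_eval {n : ℕ} {S : Finset (Fin n)} {i : Fin n} (hi : i ∉ S)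
    {ψ : (S → Obs d) × Obs d → ℝ≥0∞} (hψ : Measurable ψ) :
    ∫⁻ z, ψ (fun j => z j, z i) ∂(sampleLaw P n) =
      ∫⁻ z, ∫⁻ o, ψ (fun j => z j, o) ∂(obsLaw P) ∂(sampleLaw P n) := by
  have hres : Measurable fun (z : Fin n → Obs d) (j : S) => z j := by fun_prop
  have hind : IndepFun (fun (z : Fin n → Obs d) (j : S) => z j) (fun z => z i)
      (sampleLaw P n) :=
    ((iIndepFun_pi (μ := fun _ : Fin n => obsLaw P) (X := fun _ o => o)
      fun _ => aemeasurable_id).indepFun_finset S {i} (by simpa using hi)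
      fun j => by fun_prop).comp measurable_id
        (measurable_pi_apply (⟨i, Finset.mem_singleton_self i⟩ : ({i} : Finset (Fin n))))
  have hmap := (indepFun_iff_map_prod_eq_prod_map_map hres.aemeasurable
    (measurable_pi_apply i).aemeasurable).1 hind
  rw [(measurePreserving_eval_sampleLaw (P := P) i).map_eq] at hmap
  rw [← lintegral_map hψ (hres.prodMk (measurable_pi_apply i)), hmap,
    lintegral_prod _ hψ.aemeasurable, lintegral_map hψ.lintegral_prod_right' hres]

/-- A conditional bound given the data of the fold `S`, averaged over an event of that fold. -/
lemma setLIntegral_restrict_eval_le {n : ℕ} {S : Finset (Fin n)} {i : Fin n} (hi : i ∉ S)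
    {ψ : (S → Obs d) × Obs d → ℝ≥0∞} (hψ : Measurable ψ) {G : Set (S → Obs d)}
    (hG : MeasurableSet G) {c : ℝ≥0∞} (h : ∀ u ∈ G, ∫⁻ o, ψ (u, o) ∂(obsLaw P) ≤ c) :
    ∫⁻ z in {z | (fun j : S => z j) ∈ G}, ψ (fun j => z j, z i) ∂(sampleLaw P n) ≤ c := by
  have hres : Measurable fun (z : Fin n → Obs d) (j : S) => z j := by fun_prop
  have hG' : MeasurableSet {z : Fin n → Obs d | (fun j : S => z j) ∈ G} := hres hG
  rw [← lintegral_indicator hG']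
  have h1 := lintegral_restrict_eval (P := P) hi
    (ψ := (Prod.fst ⁻¹' G).indicator ψ) (hψ.indicator (measurable_fst hG))
  calc _ = ∫⁻ z, (Prod.fst ⁻¹' G).indicator ψ (fun j => z j, z i) ∂(sampleLaw P n) := rfl
    _ = _ := h1
    _ ≤ ∫⁻ _ : Fin n → Obs d, c ∂(sampleLaw P n) := by
        refine lintegral_mono fun z => ?_
        by_cases hz : (fun j : S => z j) ∈ G
        · exact (lintegral_mono fun o => Set.indicator_le_self _ _ _).trans (h _ hz)
        · have h0 (o : Obs d) : (Prod.fst ⁻¹' G).indicator ψ (fun j => z j, o) = 0 :=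
            Set.indicator_of_notMem (s := Prod.fst ⁻¹' G) hz _
          simp [h0]
    _ = c := by simp

/-- The score with nuisances fitted on the fold `S` converges in mean to the score with the true
nuisances, over a fresh observation and with probability tending to one over the fold. -/
lemma withHighProb_lintegral_score_sub_oracle_le {η C : ℝ} (hη : 0 < η)
    (hov : ∀ᵐ x ∂(covLaw P), η < propensity P x ∧ propensity P x < 1 - η)
    (hout : ∀ᵐ u ∂P, |outcome u| ≤ C)
    (hreg : ∀ t, ∀ᵐ x ∂(covLaw P), |regression P t x| ≤ C)
    {f g : Cov d → ℝ} (hf : Measurable f) (hg : Measurable g)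
    (hf2 : MemLp f 2 (covLaw P)) (hg2 : MemLp g 2 (covLaw P))
    {L : Learner d} (hL : L.IsMeasurable) {S : (n : ℕ) → Finset (Fin n)}
    (hcons : ConsistentNuisance P L S) (hovS : EstimatedOverlap P L S) {δ : ℝ} (hδ : 0 < δ) :
    WithHighProb P fun n z =>
      ∫⁻ o, ‖score (L.fit (S n) z) f g o - score (oracle P) f g o‖ₑ ∂(obsLaw P) ≤
        ENNReal.ofReal δ := by
  obtain ⟨η', hη', hovS⟩ := hovS
  set c : ℝ := 2 * (1 + 1 / η' + (C + C) / (η' * η))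
  set M : ℝ≥0∞ := ENNReal.ofReal c * eLpNorm (fun x => f x - g x) 2 (covLaw P) with hM
  have hMtop : M ≠ ∞ := ENNReal.mul_ne_top ENNReal.ofReal_ne_top (hf2.sub hg2).eLpNorm_ne_top
  set θ : ℝ := δ / (3 * (M.toReal + 1)) with hθ
  have hM0 : 0 ≤ M.toReal := ENNReal.toReal_nonneg
  have hθ0 : 0 < θ := by positivity
  have hmu (t : Bool) : WithHighProb P fun n z =>
      eLpNorm (fun x => (L.fit (S n) z).mu t x - regression P t x) 2 (covLaw P) <
        ENNReal.ofReal θ := by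
    simpa [WithHighProb] using hcons.1 t θ hθ0
  have he : WithHighProb P fun n z =>
      eLpNorm (fun x => (L.fit (S n) z).e x - propensity P x) 2 (covLaw P) <
        ENNReal.ofReal θ := by
    simpa [WithHighProb] using hcons.2.1 θ hθ0
  have hov' : WithHighProb P fun n z =>
      ∀ᵐ x ∂(covLaw P), η' < (L.fit (S n) z).e x ∧ (L.fit (S n) z).e x < 1 - η' := hovS
  refine (((hmu true).and (hmu false)).and (he.and hov')).mono ?_
  rintro n z ⟨⟨h1, h0⟩, h2, h3⟩
  have hmeas : (∀ t, Measurable ((L.fit (S n) z).mu t)) ∧ Measurable (L.fit (S n) z).e := by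
    have hpair : Measurable fun x : Cov d => ((fun i : S n => z i : S n → Obs d), x) := by fun_prop
    exact ⟨fun t => ((hL n (S n)).1 t).comp hpair, (hL n (S n)).2.comp hpair⟩
  refine (lintegral_score_sub_oracle_le hη hη' hov hout hreg hf hg hmeas.1 hmeas.2 h3).trans ?_
  rw [← mul_assoc]
  change M * _ ≤ _
  calc M * _ ≤ M * (ENNReal.ofReal θ + ENNReal.ofReal θ + ENNReal.ofReal θ) :=
        mul_le_mul_right (add_le_add (add_le_add h1.le h0.le) h2.le) _
    _ = ENNReal.ofReal (M.toReal * (θ + θ + θ)) := by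
        rw [ENNReal.ofReal_mul hM0, ENNReal.ofReal_toReal hMtop,
          ENNReal.ofReal_add (by positivity) hθ0.le, ENNReal.ofReal_add hθ0.le hθ0.le]
    _ ≤ ENNReal.ofReal δ := by
        refine ENNReal.ofReal_le_ofReal ?_
        have : M.toReal * (θ + θ + θ) = δ * (M.toReal / (M.toReal + 1)) := by
          rw [hθ]; field_simp; ring
        rw [this]
        exact mul_le_of_le_one_right hδ.le ((div_le_one (by positivity)).2 (by linarith))

/-- On a fold `A` disjoint from the training fold `S`, replacing the fitted nuisances by the true
ones changes the scores by `o_p(1)` on average. Given the training fold, the observations in `A`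
are fresh, so that Markov's inequality applies conditionally. -/
lemma withHighProb_sum_abs_score_sub_oracle_le {η C : ℝ} (hη : 0 < η)
    (hov : ∀ᵐ x ∂(covLaw P), η < propensity P x ∧ propensity P x < 1 - η)
    (hout : ∀ᵐ u ∂P, |outcome u| ≤ C)
    (hreg : ∀ t, ∀ᵐ x ∂(covLaw P), |regression P t x| ≤ C)
    {f g : Cov d → ℝ} (hf : Measurable f) (hg : Measurable g)
    (hf2 : MemLp f 2 (covLaw P)) (hg2 : MemLp g 2 (covLaw P))
    {L : Learner d} (hL : L.IsMeasurable) {A S : (n : ℕ) → Finset (Fin n)}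
    (hAS : ∀ n, Disjoint (A n) (S n))
    (hcons : ConsistentNuisance P L S) (hovS : EstimatedOverlap P L S) {ε : ℝ} (hε : 0 < ε) :
    WithHighProb P fun n z =>
      ∑ i ∈ A n, |score (L.fit (S n) z) f g (z i) - score (oracle P) f g (z i)| ≤
        ε * (A n).card := by
  refine WithHighProb.of_forall_le fun κ hκ => ⟨_, withHighProb_lintegral_score_sub_oracle_le hη
    hov hout hreg hf hg hf2 hg2 hL hcons hovS (mul_pos hκ hε), Eventually.of_forall fun n => ?_⟩
  have hR : Measurable fun p : (S n → Obs d) × Obs d =>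
      score (L n (S n) p.1) f g p.2 - score (oracle P) f g p.2 :=
    (measurable_score (hL n (S n)).1 (hL n (S n)).2 hf hg).sub
      ((measurable_score_oracle P hf hg).comp measurable_snd)
  have hres : Measurable fun (z : Fin n → Obs d) (j : S n) => z j := by fun_prop
  refine measure_inter_lt_sum_abs_le (sampleLaw P n) (A n)
    (r := fun i z => score (L.fit (S n) z) f g (z i) - score (oracle P) f g (z i))
    (fun i _ => hR.comp (hres.prodMk (measurable_pi_apply i))) hκ hε fun i hi => ?_
  exact setLIntegral_restrict_eval_le (Finset.disjoint_left.1 (hAS n) hi) hR.enorm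
    (G := {u | ∫⁻ o, ‖score (L n (S n) u) f g o - score (oracle P) f g o‖ₑ ∂(obsLaw P) ≤
      ENNReal.ofReal (κ * ε)})
    (measurableSet_le hR.enorm.lintegral_prod_right' measurable_const) fun u hu => hu

/-! ### The estimated relative error and its estimated variance -/

variable {n K : ℕ}

/-- Averages over the two folds transfer from the true scores `t` to the fitted scores `t'`. -/
lemma abs_fold_average_sub_le {A : Finset (Fin n)} (hA : 0 < A.card) {t t' : Fin n → ℝ} {D ε : ℝ}
    (hdiff : ∑ i ∈ A, |t' i - t i| ≤ ε * A.card) (hlln : |∑ i ∈ A, t i - A.card * D| ≤ ε * A.card) :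
    |1 / (A.card : ℝ) * ∑ i ∈ A, t' i - D| ≤ 2 * ε := by
  have hc : (0 : ℝ) < A.card := by exact_mod_cast hA
  have h1 : |∑ i ∈ A, t' i - ∑ i ∈ A, t i| ≤ ε * A.card := by
    rw [← Finset.sum_sub_distrib]
    exact (Finset.abs_sum_le_sum_abs _ _).trans hdiff
  have h2 : 1 / (A.card : ℝ) * ∑ i ∈ A, t' i - D =
      ((∑ i ∈ A, t' i - ∑ i ∈ A, t i) + (∑ i ∈ A, t i - A.card * D)) / A.card := by
    field_simp
    ring
  rw [h2, abs_div, abs_of_pos hc, div_le_iff₀ hc]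
  refine (abs_add_le _ _).trans ((add_le_add h1 hlln).trans_eq ?_)
  ring

/-- The diagonal of the estimated covariance, bounded through
`(t'ᵢ - c)² ≤ 3 ((t'ᵢ - tᵢ)² + tᵢ² + c²)`. -/
lemma sum_sub_sq_le {t t' : Fin n → ℝ} {c ε : ℝ}
    (hdiff : ∑ i, |t' i - t i| ≤ ε * n) (hsq : ∑ i, t i ^ 2 ≤ ε ^ 2 * (n : ℝ) ^ 2) :
    ∑ i, (t' i - c) ^ 2 ≤ 6 * ε ^ 2 * (n : ℝ) ^ 2 + 3 * n * c ^ 2 := by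
  have h1 : ∑ i, (t' i - t i) ^ 2 ≤ (ε * n) ^ 2 := by
    simp_rw [← sq_abs (t' _ - t _)]
    exact (Finset.sum_sq_le_sq_sum_of_nonneg fun i _ => abs_nonneg _).trans
      (pow_le_pow_left₀ (Finset.sum_nonneg fun i _ => abs_nonneg _) hdiff 2)
  have h2 : ∑ i, (t' i - c) ^ 2 ≤
      3 * ∑ i, (t' i - t i) ^ 2 + 3 * ∑ i, t i ^ 2 + ∑ _i : Fin n, 3 * c ^ 2 := by
    rw [Finset.mul_sum, Finset.mul_sum, ← Finset.sum_add_distrib, ← Finset.sum_add_distrib]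
    refine Finset.sum_le_sum fun i _ => ?_
    nlinarith [sq_nonneg (t' i - t i - t i), sq_nonneg (t' i - t i + c), sq_nonneg (t i + c)]
  rw [Finset.sum_const, Finset.card_univ, Fintype.card_fin, nsmul_eq_mul] at h2
  nlinarith

/-- For candidates `f`, `g` with `δ(f, g) < 0`, the estimate of `δ(f, g)` is eventually at most
`δ(f, g) / 2`, and its estimated variance tends to zero. -/
lemma withHighProb_relErrHat_le_and_variance_le {η C : ℝ} (hunc : Unconfounded P) (hη : 0 < η)
    (hov : ∀ᵐ x ∂(covLaw P), η < propensity P x ∧ propensity P x < 1 - η)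
    (hout : ∀ᵐ u ∂P, |outcome u| ≤ C)
    {f g : Cov d → ℝ} (hf : Measurable f) (hg : Measurable g)
    (hf2 : MemLp f 2 (covLaw P)) (hg2 : MemLp g 2 (covLaw P))
    (A : (n : ℕ) → Finset (Fin n))
    (hA : Tendsto (fun n => ((A n).card : ℝ) / (n : ℝ)) atTop (𝓝 (1 / 2)))
    {L : Learner d} (hL : L.IsMeasurable)
    (hconsA : ConsistentNuisance P L A) (hconsB : ConsistentNuisance P L fun n => (A n)ᶜ)
    (hovA : EstimatedOverlap P L A) (hovB : EstimatedOverlap P L fun n => (A n)ᶜ)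
    (hfg : relErr P f g < 0) {κ : ℝ} (hκ : 0 < κ) :
    WithHighProb P fun n z => relErrHat L (A n) z f g ≤ relErr P f g / 2 ∧
      1 / (n : ℝ) * (1 / (n : ℝ) *
        ∑ i, (crossScore L (A n) z f g i - relErrHat L (A n) z f g) ^ 2) ≤ κ := by
  have hpos := ae_armProb_pos hη hov
  have hpot := ae_abs_pot_le hunc hpos hout
  have hreg := ae_abs_regression_le hunc hpos hout
  have hm := measurable_score_oracle P hf hg
  obtain ⟨hint, hmean⟩ :=
    integrable_score_oracle_and_integral_eq hunc hη hov hpot hreg hf hg hf2 hg2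
  set D : ℝ := relErr P f g
  have hcardA : Tendsto (fun n => ((A n).card : ℝ)) atTop atTop := by
    have := hA.pos_mul_atTop (by norm_num) tendsto_natCast_atTop_atTop
    refine this.congr' ?_
    filter_upwards [eventually_gt_atTop 0] with n hn
    field_simp
  have hcardB : Tendsto (fun n => (((A n)ᶜ).card : ℝ)) atTop atTop := by
    have h1 : Tendsto (fun n => 1 - ((A n).card : ℝ) / (n : ℝ)) atTop (𝓝 (1 - 1 / 2)) :=
      hA.const_sub 1
    have := h1.pos_mul_atTop (by norm_num) tendsto_natCast_atTop_atTop
    refine this.congr' ?_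
    filter_upwards [eventually_gt_atTop 0] with n hn
    rw [Finset.card_compl, Fintype.card_fin,
      Nat.cast_sub ((Finset.card_le_univ _).trans_eq (Fintype.card_fin n))]
    field_simp
  -- `4 ε ≤ |D|` puts the estimate below `D / 2`; `12 ε² ≤ κ` takes half of the variance budget.
  obtain ⟨ε, hε, hεD, hεκ⟩ : ∃ ε : ℝ, 0 < ε ∧ 4 * ε ≤ -D ∧ 12 * ε ^ 2 ≤ κ := by
    have hD : 0 < -D / 4 := by linarith
    refine ⟨min (-D / 4) (√κ / 4), by positivity, ?_, ?_⟩
    · linarith [min_le_left (-D / 4) (√κ / 4)]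
    · have h1 : min (-D / 4) (√κ / 4) ^ 2 ≤ (√κ / 4) ^ 2 :=
        pow_le_pow_left₀ (by positivity) (min_le_right _ _) 2
      rw [div_pow, Real.sq_sqrt hκ.le] at h1
      linarith
  have hdA := withHighProb_sum_abs_score_sub_oracle_le hη hov hout hreg hf hg hf2 hg2 hL
    (A := A) (S := fun n => (A n)ᶜ) (fun n => disjoint_compl_right) hconsB hovB hε
  have hdB := withHighProb_sum_abs_score_sub_oracle_le hη hov hout hreg hf hg hf2 hg2 hL
    (A := fun n => (A n)ᶜ) (S := A) (fun n => disjoint_compl_left) hconsA hovA hε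
  have hlA := withHighProb_abs_sum_sub_le hm hint hcardA hε
  have hlB := withHighProb_abs_sum_sub_le hm hint hcardB hε
  have hsq := withHighProb_sum_sq_le hm hint (ε := ε ^ 2) (by positivity)
  rw [hmean] at hlA hlB
  refine (((hdA.and hdB).and (hlA.and hlB)).and hsq).mono_eventually ?_
  -- The other half of the variance budget, `3 δ̂² / n ≤ κ / 2`, is met for large `n`, since
  -- `|δ̂| ≤ 2 |D|`.
  filter_upwards [hcardA.eventually_gt_atTop 0, hcardB.eventually_gt_atTop 0,
    eventually_gt_atTop 0,
    tendsto_natCast_atTop_atTop.eventually_ge_atTop (6 * (2 * D) ^ 2 / κ)] with n hnA hnB hn hnκ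
  rintro z ⟨⟨⟨h1, h2⟩, h3, h4⟩, h5⟩
  have hn' : (0 : ℝ) < n := by exact_mod_cast hn
  have hsA : ∑ i ∈ A n, |crossScore L (A n) z f g i - score (oracle P) f g (z i)| ≤
      ε * (A n).card := by
    refine le_of_eq_of_le (Finset.sum_congr rfl fun i hi => ?_) h1
    rw [crossScore, if_pos hi]
  have hsB : ∑ i ∈ (A n)ᶜ, |crossScore L (A n) z f g i - score (oracle P) f g (z i)| ≤
      ε * ((A n)ᶜ).card := by
    refine le_of_eq_of_le (Finset.sum_congr rfl fun i hi => ?_) h2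
    rw [crossScore, if_neg (Finset.mem_compl.1 hi)]
  have haA := abs_fold_average_sub_le (by exact_mod_cast hnA) hsA h3
  have haB := abs_fold_average_sub_le (by exact_mod_cast hnB) hsB h4
  have hhat : |relErrHat L (A n) z f g - D| ≤ 2 * ε := by
    rw [abs_le] at haA haB ⊢
    rw [relErrHat]
    constructor <;> linarith [haA.1, haA.2, haB.1, haB.2]
  rw [abs_le] at hhat
  refine ⟨by linarith [hhat.2], ?_⟩
  have hs : ∑ i, |crossScore L (A n) z f g i - score (oracle P) f g (z i)| ≤ ε * n := by
    rw [← Finset.sum_add_sum_compl (A n)]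
    refine (add_le_add hsA hsB).trans_eq ?_
    rw [← mul_add, ← Nat.cast_add, Finset.card_add_card_compl, Fintype.card_fin]
  have hv := sum_sub_sq_le (c := relErrHat L (A n) z f g) hs h5
  have hc2 : relErrHat L (A n) z f g ^ 2 ≤ (2 * D) ^ 2 := by
    rw [sq_le_sq, abs_le, abs_of_nonpos (by linarith : 2 * D ≤ 0)]
    constructor <;> linarith [hhat.1, hhat.2]
  rw [div_le_iff₀ hκ] at hnκ
  rw [← mul_assoc, one_div_mul_one_div, one_div_mul_eq_div, div_le_iff₀ (by positivity)]
  have h6 : 6 * ε ^ 2 * (n : ℝ) ^ 2 ≤ κ / 2 * (n : ℝ) ^ 2 := by gcongr; linarith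
  have h7 : 3 * n * relErrHat L (A n) z f g ^ 2 ≤ 3 * n * (2 * D) ^ 2 := by gcongr
  nlinarith

end CrossFitting

section Bootstrap

/-! ### The bootstrap critical value -/

/-- If the empirical `p`-quantile is below `a`, then at least a fraction `p` of the values is at
most `a`. -/
lemma le_card_of_empQuantile_lt {B : ℕ} (hB : 0 < B) {p : ℝ} (hp : p ≤ 1) {M : Fin B → ℝ} {a : ℝ}
    (h : empQuantile p M < a) :
    p * B ≤ ((Finset.univ.filter fun b => M b ≤ a).card : ℝ) := by
  have hB' : (0 : ℝ) < B := by exact_mod_cast hB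
  obtain ⟨c, hc⟩ := (Set.finite_range M).bddAbove
  have hne : {c : ℝ | p ≤ ((Finset.univ.filter fun b => M b ≤ c).card : ℝ) / (B : ℝ)}.Nonempty := by
    refine ⟨c, ?_⟩
    have hall : (Finset.univ.filter fun b => M b ≤ c) = Finset.univ :=
      Finset.filter_true_of_mem fun b _ => hc ⟨b, rfl⟩
    rw [Set.mem_ofPred_eq, hall, Finset.card_univ, Fintype.card_fin, div_self hB'.ne']
    exact hp
  obtain ⟨x, hx, hxa⟩ := exists_lt_of_csInf_lt hne h
  refine ((le_div_iff₀ hB').1 hx).trans ?_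
  gcongr

lemma empQuantile_nonneg {B : ℕ} {p : ℝ} (hp : 0 < p) {M : Fin B → ℝ} (hM : ∀ b, 0 ≤ M b) :
    0 ≤ empQuantile p M := by
  refine Real.sInf_nonneg fun c hc => ?_
  by_contra! hneg
  have hempty : (Finset.univ.filter fun b => M b ≤ c) = ∅ :=
    Finset.filter_false_of_mem fun b _ => not_le.2 (hneg.trans_le (hM b))
  rw [Set.mem_ofPred_eq, hempty, Finset.card_empty, Nat.cast_zero, zero_div] at hc
  exact hp.not_ge hc

/-- The empirical quantile of an i.i.d. sample is below `a` with probability at most `1 / p` times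
the probability that a single value is at most `a`. -/
lemma pi_empQuantile_lt_le {E : Type*} [MeasurableSpace E] (ν : Measure E) [IsProbabilityMeasure ν]
    {B : ℕ} (hB : 0 < B) {p : ℝ} (hp0 : 0 < p) (hp : p ≤ 1) {T : E → ℝ} {a : ℝ} {U : Set E}
    (hU : MeasurableSet U) (hTU : ∀ x, T x ≤ a → x ∈ U) :
    Measure.pi (fun _ : Fin B => ν) {G | empQuantile p (fun b => T (G b)) < a} ≤
      ν U / ENNReal.ofReal p := by
  have hB' : (0 : ℝ) < B := by exact_mod_cast hB
  have hmb (b : Fin B) : Measurable fun G : Fin B → E =>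
      U.indicator (fun _ => (1 : ℝ≥0∞)) (G b) :=
    (measurable_const.indicator hU).comp (measurable_pi_apply b)
  have hm : Measurable fun G : Fin B → E => ∑ b, U.indicator (fun _ => (1 : ℝ≥0∞)) (G b) :=
    Finset.measurable_fun_sum _ fun b _ => hmb b
  have hsub : {G : Fin B → E | empQuantile p (fun b => T (G b)) < a} ⊆
      {G | ENNReal.ofReal (p * B) ≤ ∑ b, U.indicator (fun _ => (1 : ℝ≥0∞)) (G b)} := by
    intro G hG
    have h1 := le_card_of_empQuantile_lt hB hp hG
    refine (ENNReal.ofReal_le_ofReal h1).trans ?_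
    rw [ENNReal.ofReal_natCast, Finset.card_filter, Nat.cast_sum]
    refine Finset.sum_le_sum fun b _ => ?_
    by_cases hb : T (G b) ≤ a
    · simp [hb, hTU _ hb]
    · simp [hb]
  refine (measure_mono hsub).trans ((meas_ge_le_lintegral_div hm.aemeasurable
    (ENNReal.ofReal_pos.2 (mul_pos hp0 hB')).ne' ENNReal.ofReal_ne_top).trans ?_)
  have hint : ∫⁻ G, ∑ b, U.indicator (fun _ => (1 : ℝ≥0∞)) (G b)
      ∂(Measure.pi fun _ : Fin B => ν) = B * ν U := by
    rw [lintegral_finsetSum _ fun b _ => hmb b]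
    have h1 (b : Fin B) : ∫⁻ G, U.indicator (fun _ => (1 : ℝ≥0∞)) (G b)
        ∂(Measure.pi fun _ : Fin B => ν) = ν U := by
      rw [(measurePreserving_eval (fun _ : Fin B => ν) b).lintegral_comp
        (measurable_const.indicator hU), lintegral_indicator_const hU, one_mul]
    simp [h1]
  rw [hint, ENNReal.ofReal_mul hp0.le, ENNReal.ofReal_natCast, mul_comm (ENNReal.ofReal p)]
  exact (ENNReal.mul_div_mul_left _ _ (by exact_mod_cast hB.ne') (ENNReal.natCast_ne_top _)).le

/-- Chebyshev's inequality for a standardized coordinate of a Gaussian vector. -/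
lemma multivariateGaussian_coord_le {ι : Type*} [Fintype ι] [DecidableEq ι] {S : Matrix ι ι ℝ}
    (hS : S.PosSemidef) {s : ι} (hs : 0 < S s s) {M : ℝ} (hM : 0 < M) :
    multivariateGaussian 0 S {x | x s / √(S s s) ≤ -M} ≤ ENNReal.ofReal (1 / M ^ 2) := by
  have hmp := measurePreserving_eval_multivariateGaussian (μ := 0) hS (i := s)
  have hsq : 0 < √(S s s) := Real.sqrt_pos.2 hs
  have hmeas : MeasurableSet {y : ℝ | y / √(S s s) ≤ -M} :=
    measurableSet_le (by fun_prop) measurable_const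
  have h1 := hmp.measure_preimage hmeas.nullMeasurableSet
  have h2 := meas_ge_le_variance_div_sq (μ := gaussianReal 0 (S s s).toNNReal) (X := id)
    (memLp_id_gaussianReal 2) (mul_pos hM hsq)
  refine (h1.trans_le (measure_mono ?_)).trans (h2.trans_eq ?_)
  · intro y hy
    have hy' : y ≤ -M * √(S s s) := (div_le_iff₀ hsq).1 hy
    have hint : ∫ x, id x ∂(gaussianReal 0 (S s s).toNNReal) = 0 := integral_id_gaussianReal
    rw [Set.mem_ofPred_eq, hint, id, sub_zero]
    linarith [neg_le_abs y]
  · rw [variance_id_gaussianReal, Real.coe_toNNReal _ hs.le, mul_pow, Real.sq_sqrt hs.le]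
    congr 1
    field_simp

variable {d n K : ℕ}

lemma posSemidef_covHat (L : Learner d) (A : Finset (Fin n)) (z : Fin n → Obs d)
    (τhat : Fin K → Cov d → ℝ) (m : Fin K) : (covHat L A z τhat m).PosSemidef := by
  set V : Matrix (Fin n) (Others m) ℝ := Matrix.of fun i s => 1 / (n : ℝ) *
    (crossScore L A z (τhat m) (τhat s) i - relErrHat L A z (τhat m) (τhat s)) with hV
  have h : covHat L A z τhat m = V.conjTranspose * V := by
    ext s s'
    simp only [covHat, hV, Matrix.mul_apply, Matrix.conjTranspose_apply, Matrix.of_apply,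
      star_trivial, Finset.mul_sum]
    exact Finset.sum_congr rfl fun i _ => by ring
  rw [h]
  exact Matrix.posSemidef_conjTranspose_mul_self V

instance (L : Learner d) (A : Finset (Fin n)) (τhat : Fin K → Cov d → ℝ) (B : ℕ)
    (z : Fin n → Obs d) : IsProbabilityMeasure (bootLaw L A τhat B z) := by
  unfold bootLaw; infer_instance

/-- If every estimate `δ̂(τ̂_m, τ̂_s)` is negative and at least `M` estimated standard deviations
away from `0`, then the bootstrap rejects `m` with small conditional probability. A vanishing
estimated variance makes the statistic `0` but also keeps the critical value nonnegative. -/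
lemma one_le_bootLaw_add {L : Learner d} {A : Finset (Fin n)} {τhat : Fin K → Cov d → ℝ} {α : ℝ}
    (hα0 : 0 < α) (hα1 : α < 1) {B : ℕ} (hB : 0 < B) {z : Fin n → Obs d} {m : Fin K} {M : ℝ}
    (hM : 0 < M)
    (h : ∀ s : Others m, relErrHat L A z (τhat m) (τhat s) < 0 ∧
      M * √(covHat L A z τhat m s s) ≤ -relErrHat L A z (τhat m) (τhat s)) :
    1 ≤ bootLaw L A τhat B z {G | m ∈ naiveSet L A τhat α z G} +
      ENNReal.ofReal (1 / M ^ 2) / ENNReal.ofReal (1 - α) := by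
  set S := covHat L A z τhat m
  have hS : S.PosSemidef := posSemidef_covHat L A z τhat m
  have hbdd (x : EuclideanSpace ℝ (Others m)) : BddAbove (Set.range fun s => x s / √(S s s)) :=
    (Set.finite_range _).bddAbove
  by_cases hdeg : ∀ s, 0 < S s s
  · rcases isEmpty_or_nonempty (Others m) with hemp | ⟨⟨s₀⟩⟩
    · have hall : {G | m ∈ naiveSet (B := B) L A τhat α z G} = Set.univ := by
        refine Set.eq_univ_of_forall fun G => ?_
        change maxStat L A z τhat m ≤ critVal α S (G m)
        rw [maxStat, Real.iSup_of_isEmpty]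
        exact empQuantile_nonneg (by linarith) fun b => (Real.iSup_of_isEmpty _).ge
      rw [hall, measure_univ]
      exact le_self_add
    · have : Nonempty (Others m) := ⟨s₀⟩
      have hstat : maxStat L A z τhat m ≤ -M := by
        refine ciSup_le fun s => ?_
        rw [div_le_iff₀ (Real.sqrt_pos.2 (hdeg s))]
        linarith [(h s).2]
      set E := {G | m ∈ naiveSet (B := B) L A τhat α z G} with hE
      have hcompl : Eᶜ ⊆ Function.eval m ⁻¹' {G : Fin B → EuclideanSpace ℝ (Others m) |
          empQuantile (1 - α) (fun b => ⨆ s : Others m, G b s / √(S s s)) < -M} := by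
        intro G hG
        have hG' : ¬ maxStat L A z τhat m ≤ critVal α S (G m) := hG
        exact (not_le.1 hG').trans_le hstat
      have hle : bootLaw L A τhat B z Eᶜ ≤
          ENNReal.ofReal (1 / M ^ 2) / ENNReal.ofReal (1 - α) := by
        refine (measure_mono hcompl).trans ((Measure.le_map_apply
          (measurable_pi_apply m).aemeasurable _).trans ?_)
        rw [bootLaw, (measurePreserving_eval _ m).map_eq]
        refine (pi_empQuantile_lt_le (multivariateGaussian 0 S) hB (by linarith) (by linarith)
          (T := fun x => ⨆ s : Others m, x s / √(S s s)) (U := {x | x s₀ / √(S s₀ s₀) ≤ -M})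
          (measurableSet_le (by fun_prop) measurable_const)
          fun x hx => (le_ciSup (hbdd x) s₀).trans hx).trans ?_
        exact ENNReal.div_le_div_right (multivariateGaussian_coord_le hS (hdeg s₀) hM) _
      calc (1 : ℝ≥0∞) = bootLaw L A τhat B z (E ∪ Eᶜ) := by
            rw [Set.union_compl_self, measure_univ]
        _ ≤ _ := (measure_union_le _ _).trans (add_le_add le_rfl hle)
  · obtain ⟨s₀, hs₀⟩ := not_forall.1 hdeg
    have hall : {G | m ∈ naiveSet (B := B) L A τhat α z G} = Set.univ := by
      refine Set.eq_univ_of_forall fun G => ?_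
      change maxStat L A z τhat m ≤ critVal α S (G m)
      refine le_trans (b := 0) (Real.iSup_le (fun s => ?_) le_rfl)
        (empQuantile_nonneg (by linarith) fun b => ?_)
      · exact div_nonpos_of_nonpos_of_nonneg (h s).1.le (Real.sqrt_nonneg _)
      · refine le_of_eq_of_le ?_ (le_ciSup (hbdd (G m b)) s₀)
        rw [Real.sqrt_eq_zero_of_nonpos (not_lt.1 hs₀), div_zero]
    rw [hall, measure_univ]
    exact le_self_add

/-- If a conditional probability `F` is at least `1 - p` on an event `G`, then the unconditional one
is at least `1 - p` minus the probability of the complement of `G`. -/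
lemma one_le_lintegral_add {Ω : Type*} [MeasurableSpace Ω] {μ : Measure Ω}
    [IsProbabilityMeasure μ] {F : Ω → ℝ≥0∞} {p : ℝ≥0∞} {G : Set Ω}
    (h : ∀ z ∈ G, 1 ≤ F z + p) : 1 ≤ ∫⁻ z, F z ∂μ + (p + μ Gᶜ) := by
  -- `G` and `F` need not be measurable, so `Gᶜ` is enlarged to a measurable set of equal measure.
  set T := toMeasurable μ Gᶜ with hT
  have hTm : MeasurableSet T := measurableSet_toMeasurable _ _
  calc (1 : ℝ≥0∞) = ∫⁻ _, 1 ∂μ := by simp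
    _ ≤ ∫⁻ z, F z + (p + T.indicator (fun _ => 1) z) ∂μ := by
        refine lintegral_mono fun z => ?_
        by_cases hz : z ∈ G
        · rw [← add_assoc]
          exact (h z hz).trans le_self_add
        · have : T.indicator (fun _ => (1 : ℝ≥0∞)) z = 1 :=
            Set.indicator_of_mem (subset_toMeasurable μ Gᶜ hz) _
          rw [this, ← add_assoc]
          exact le_add_self
    _ = ∫⁻ z, F z ∂μ + (p + μ Gᶜ) := by
        have hi : Measurable (T.indicator fun _ => (1 : ℝ≥0∞)) := measurable_const.indicator hTm
        have hpi : Measurable fun z => p + T.indicator (fun _ => (1 : ℝ≥0∞)) z :=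
          measurable_const.add hi
        rw [lintegral_add_right _ hpi, lintegral_add_right _ hi,
          lintegral_indicator_const hTm, lintegral_const, measure_univ, mul_one, one_mul, hT,
          measure_toMeasurable]

/-- The probability of selecting the true winner tends to one. -/
lemma tendsto_selectProb_one
    (P : Measure (Full d)) [IsProbabilityMeasure P]
    (hunc : Unconfounded P) (hbdd : BoundedOverlap P)
    (τhat : Fin K → Cov d → ℝ) (hmeas : ∀ k, Measurable (τhat k))
    (hL2 : ∀ k, MemLp (τhat k) 2 (covLaw P))
    (A : (n : ℕ) → Finset (Fin n))
    (hA : Tendsto (fun n => ((A n).card : ℝ) / (n : ℝ)) atTop (𝓝 (1 / 2)))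
    (L : Learner d) (hL : L.IsMeasurable)
    (hconsA : ConsistentNuisance P L A) (hconsB : ConsistentNuisance P L fun n => (A n)ᶜ)
    (hovA : EstimatedOverlap P L A) (hovB : EstimatedOverlap P L fun n => (A n)ᶜ)
    {α : ℝ} (hα0 : 0 < α) (hα1 : α < 1) {B : ℕ → ℕ} (hB : ∀ n, 0 < B n)
    {w : Fin K} (hw : ∀ s, s ≠ w → relErr P (τhat w) (τhat s) < 0) :
    Tendsto (fun n => selectProb P L (A n) τhat α (B n) w) atTop (𝓝 1) := by
  obtain ⟨⟨C, hC⟩, η, hη, hov⟩ := hbdd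
  have hle1 (n : ℕ) : ∫⁻ z, bootLaw L (A n) τhat (B n) z
      {G | w ∈ naiveSet L (A n) τhat α z G} ∂(sampleLaw P n) ≤ 1 := by
    refine (lintegral_mono fun z => prob_le_one).trans ?_
    simp
  have hlow : ∀ ε : ℝ, 0 < ε →
      ∀ᶠ n in atTop, 1 - ε ≤ selectProb P L (A n) τhat α (B n) w := by
    intro ε hε
    have h1α : 0 < 1 - α := by linarith
    -- With this `M`, the bound `1 / ((1 - α) M²)` on the conditional rejection probability is
    -- `ε / 2`.
    set M : ℝ := √(2 / (ε * (1 - α))) with hMdef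
    have hM : 0 < M := Real.sqrt_pos.2 (by positivity)
    have hM2 : 1 / M ^ 2 = ε / 2 * (1 - α) := by
      rw [hMdef, Real.sq_sqrt (by positivity)]
      field_simp
    have hgood : WithHighProb P fun n z => ∀ s : Others w,
        relErrHat L (A n) z (τhat w) (τhat s) < 0 ∧
        M * √(covHat L (A n) z τhat w s s) ≤ -relErrHat L (A n) z (τhat w) (τhat s) := by
      refine WithHighProb.forall_finite fun s => ?_
      have hs := hw s s.2
      have hκ : 0 < -relErr P (τhat w) (τhat s) / 2 / M := div_pos (by linarith) hM
      refine (withHighProb_relErrHat_le_and_variance_le hunc hη hov hC (hmeas w) (hmeas s)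
        (hL2 w) (hL2 s) A hA hL hconsA hconsB hovA hovB hs (pow_pos hκ 2)).mono ?_
      rintro n z ⟨h1, h2⟩
      refine ⟨by linarith, ?_⟩
      have h3 : √(covHat L (A n) z τhat w s s) ≤ -relErr P (τhat w) (τhat s) / 2 / M := by
        refine Real.sqrt_le_iff.2 ⟨hκ.le, le_of_eq_of_le ?_ h2⟩
        simp only [covHat, Matrix.of_apply, sq]
      rw [le_div_iff₀ hM] at h3
      linarith
    filter_upwards [ENNReal.tendsto_nhds_zero.1 hgood (ENNReal.ofReal (ε / 2))
      (ENNReal.ofReal_pos.2 (by positivity))] with n hn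
    have h1 := one_le_lintegral_add (μ := sampleLaw P n)
      (G := {z | ∀ s : Others w, relErrHat L (A n) z (τhat w) (τhat s) < 0 ∧
        M * √(covHat L (A n) z τhat w s s) ≤ -relErrHat L (A n) z (τhat w) (τhat s)})
      fun z hz => one_le_bootLaw_add hα0 hα1 (hB n) hM hz
    have hp : ENNReal.ofReal (1 / M ^ 2) / ENNReal.ofReal (1 - α) = ENNReal.ofReal (ε / 2) := by
      rw [← ENNReal.ofReal_div_of_pos h1α, hM2]
      congr 1
      field_simp
    rw [hp] at h1
    have h2 := h1.trans (add_le_add le_rfl (add_le_add le_rfl hn))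
    rw [← ENNReal.ofReal_add (by positivity) (by positivity), add_halves] at h2
    have htop := ne_top_of_le_ne_top ENNReal.one_ne_top (hle1 n)
    have h3 := ENNReal.toReal_mono (ENNReal.add_ne_top.2 ⟨htop, ENNReal.ofReal_ne_top⟩) h2
    rw [ENNReal.toReal_one, ENNReal.toReal_add htop ENNReal.ofReal_ne_top,
      ENNReal.toReal_ofReal hε.le] at h3
    rw [selectProb]
    linarith
  refine tendsto_order.2 ⟨fun a ha => ?_, fun a ha => Eventually.of_forall fun n => ?_⟩
  · filter_upwards [hlow ((1 - a) / 2) (by linarith)] with n hn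
    linarith
  · refine lt_of_le_of_lt ?_ ha
    exact ENNReal.toReal_mono ENNReal.one_ne_top (hle1 n)

end Bootstrap

end HTE

open HTE in
theorem mainTheorem2 {d K : ℕ}
    -- the super-population, with unconfoundedness, bounded outcomes and overlap
    (P : Measure (Full d)) [IsProbabilityMeasure P]
    (hunc : Unconfounded P) (hbdd : BoundedOverlap P)
    -- the candidates: square-integrable and pairwise non-degenerate
    (τhat : Fin K → Cov d → ℝ) (hmeas : ∀ k, Measurable (τhat k))
    (hL2 : ∀ k, MemLp (τhat k) 2 (covLaw P))
    (hnondeg : ∀ r s, r ≠ s → ∫ x, (τhat r x - τhat s x) ^ 2 ∂(covLaw P) ≠ 0)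
    -- the two folds `A n` and its complement, asymptotically of equal size
    (A : (n : ℕ) → Finset (Fin n))
    (hA : Tendsto (fun n => ((A n).card : ℝ) / (n : ℝ)) atTop (𝓝 (1 / 2)))
    -- the nuisance estimators trained on the folds
    (L : Learner d) (hL : L.IsMeasurable)
    (hconsA : ConsistentNuisance P L A) (hconsB : ConsistentNuisance P L fun n => (A n)ᶜ)
    (hovA : EstimatedOverlap P L A) (hovB : EstimatedOverlap P L fun n => (A n)ᶜ)
    -- the significance level and the numbers of bootstrap resamples
    (α : ℝ) (hα0 : 0 < α) (hα1 : α < 1) (B : ℕ → ℕ) (hB : ∀ n, 0 < B n)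
    -- the true winner
    (w : Fin K) (hw : ∀ s, s ≠ w → relErr P (τhat w) (τhat s) < 0) :
    ∃ ℓ : ℝ, Tendsto (fun n => selectProb P L (A n) τhat α (B n) w) atTop (𝓝 ℓ) ∧ 1 - α ≤ ℓ :=
  ⟨1, tendsto_selectProb_one P hunc hbdd τhat hmeas hL2 A hA L hL hconsA hconsB hovA hovB hα0 hα1
    hB hw, by linarith⟩
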